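/- Let $(M,g)$ be a 6-dimensional smooth Riemannian manifold with Levi-Civita connection $\nabla$ and curvature $R(X,Y)Z=\nabla_X\nabla_YZ-\nabla_Y\nabla_XZ-\nabla_{[X,Y]}Z$. With respect to an orthonormal basis $e_1,\dots,e_6$ of a tangent space, and with summation over repeated indices, put $g_{ij}=g(e_i,e_j)$, $R_{abcd}=g(R(e_a,e_b)e_c,e_d)$, $\rho_{ij}=R_{aija}$ (Ricci tensor), $\tau=\rho_{ii}$ (scalar curvature), $|R|^2=R_{abcd}R_{abcd}$, $$\hat R=R_{abcd}R_{abuv}R_{cduv},\qquad \mathring R=R_{abcd}R_{aucv}R_{budv},$$ $$\check R_{ij}=R_{iuvj}R_{abcu}R_{abcv},\qquad \hat R_{ij}=R_{ibac}R_{jbuv}R_{acuv},\qquad \mathring R_{ij}=R_{iabc}R_{jubv}R_{aucv}.$$ Suppose that $M$ is Einstein, i.e. $\rho=\frac{\tau}{6}\,g$ on $M$. Then at every point of $M$, with respect to every orthonormal basis of the tangent space at that point and for all $i,j\in\{1,\dots,6\}$, $$\bigl(-\tau|R|^2+4\mathring R-2\hat R\bigr)g_{ij}+12\check R_{ij}+12\hat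 R_{ij}-24\mathring R_{ij}+4\tau R_{iabc}R_{jabc}=0.$$ -/

import Mathlib

open scoped Manifold ContDiff Bundle
open Bundle FiberBundle VectorField

noncomputable section

namespace RiemannianCurvature

set_option linter.unusedSectionVars false

variable {E : Type*} [NormedAddCommGroup E] [NormedSpace ℝ E] [FiniteDimensional ℝ E]
  {H : Type*} [TopologicalSpace H] {I : ModelWithCorners ℝ E H}
  {M : Type*} [TopologicalSpace M] [ChartedSpace H M] [IsManifold I ∞ M]
  [RiemannianBundle (fun x : M ↦ TangentSpace I x)]
  [IsContMDiffRiemannianBundle I ∞ E (fun x : M ↦ TangentSpace I x)]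

instance tangentFinite (x : M) : FiniteDimensional ℝ (TangentSpace I x) :=
  inferInstanceAs (FiniteDimensional ℝ E)

/-- The right-hand side of the Koszul formula for `2 ⟨∇_X Y, Z⟩`, namely
`X⟨Y,Z⟩ + Y⟨Z,X⟩ - Z⟨X,Y⟩ + ⟨[X,Y],Z⟩ - ⟨[X,Z],Y⟩ - ⟨[Y,Z],X⟩`, at the point `x`. -/
def koszul (X Y Z : Π x : M, TangentSpace I x) (x : M) : ℝ :=
  d% (fun y ↦ inner ℝ (Y y) (Z y)) x (X x) + d% (fun y ↦ inner ℝ (Z y) (X y)) x (Y x)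
    - d% (fun y ↦ inner ℝ (X y) (Y y)) x (Z x)
    + inner ℝ (mlieBracket I X Y x) (Z x) - inner ℝ (mlieBracket I X Z x) (Y x)
    - inner ℝ (mlieBracket I Y Z x) (X x)

theorem mdiffAt_inner {X Y : Π x : M, TangentSpace I x} {x : M}
    (hX : MDiffAt (T% X) x) (hY : MDiffAt (T% Y) x) :
    MDiffAt (fun y ↦ (inner ℝ (X y) (Y y) : ℝ)) x :=
  MDifferentiableAt.inner_bundle (F := E) (E := fun x : M ↦ TangentSpace I x) hX hY

theorem koszul_tensorial_left (Y Z : Π x : M, TangentSpace I x) (x : M)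
    (hY : MDiffAt (T% Y) x) (hZ : MDiffAt (T% Z) x) :
    TensorialAt I E (fun X : Π x : M, TangentSpace I x ↦ koszul X Y Z x) x where
  smul {f X} hf hX := by
    have h1 : d% (fun y ↦ inner ℝ (Z y) ((f • X) y)) x =
        d% (fun y ↦ f y * inner ℝ (Z y) (X y)) x := by
      congr 1; ext y; simp [inner_smul_right]
    have h2 : d% (fun y ↦ inner ℝ ((f • X) y) (Y y)) x =
        d% (fun y ↦ f y * inner ℝ (X y) (Y y)) x := by
      congr 1; ext y; simp [inner_smul_left]
    simp only [koszul, h1, h2, mvfderiv_fun_mul hf (mdiffAt_inner hZ hX),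
      mvfderiv_fun_mul hf (mdiffAt_inner hX hY),
      mlieBracket_smul_left hf hX]
    simp [inner_smul_left, inner_smul_right, inner_add_left, real_inner_comm]
    ring
  add {X X'} hX hX' := by
    have h1 : d% (fun y ↦ inner ℝ (Z y) ((X + X') y)) x =
        d% (fun y ↦ inner ℝ (Z y) (X y) + inner ℝ (Z y) (X' y)) x := by
      congr 1; ext y; simp [inner_add_right]
    have h2 : d% (fun y ↦ inner ℝ ((X + X') y) (Y y)) x =
        d% (fun y ↦ inner ℝ (X y) (Y y) + inner ℝ (X' y) (Y y)) x := by
      congr 1; ext y; simp [inner_add_left]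
    simp only [koszul, h1, h2, mvfderiv_fun_add (mdiffAt_inner hZ hX) (mdiffAt_inner hZ hX'),
      mvfderiv_fun_add (mdiffAt_inner hX hY) (mdiffAt_inner hX' hY),
      mlieBracket_add_left hX hX']
    simp [inner_add_left, inner_add_right]
    ring

theorem koszul_tensorial_right (X Y : Π x : M, TangentSpace I x) (x : M)
    (hX : MDiffAt (T% X) x) (hY : MDiffAt (T% Y) x) :
    TensorialAt I E (fun Z : Π x : M, TangentSpace I x ↦ koszul X Y Z x) x where
  smul {f Z} hf hZ := by
    have h1 : d% (fun y ↦ inner ℝ (Y y) ((f • Z) y)) x =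
        d% (fun y ↦ f y * inner ℝ (Y y) (Z y)) x := by
      congr 1; ext y; simp [inner_smul_right]
    have h2 : d% (fun y ↦ inner ℝ ((f • Z) y) (X y)) x =
        d% (fun y ↦ f y * inner ℝ (Z y) (X y)) x := by
      congr 1; ext y; simp [inner_smul_left]
    simp only [koszul, h1, h2, mvfderiv_fun_mul hf (mdiffAt_inner hY hZ),
      mvfderiv_fun_mul hf (mdiffAt_inner hZ hX),
      mlieBracket_smul_right hf hZ]
    simp [inner_smul_left, inner_smul_right, inner_add_left, real_inner_comm]
    ring
  add {Z Z'} hZ hZ' := by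
    have h1 : d% (fun y ↦ inner ℝ (Y y) ((Z + Z') y)) x =
        d% (fun y ↦ inner ℝ (Y y) (Z y) + inner ℝ (Y y) (Z' y)) x := by
      congr 1; ext y; simp [inner_add_right]
    have h2 : d% (fun y ↦ inner ℝ ((Z + Z') y) (X y)) x =
        d% (fun y ↦ inner ℝ (Z y) (X y) + inner ℝ (Z' y) (X y)) x := by
      congr 1; ext y; simp [inner_add_left]
    simp only [koszul, h1, h2, mvfderiv_fun_add (mdiffAt_inner hY hZ) (mdiffAt_inner hY hZ'),
      mvfderiv_fun_add (mdiffAt_inner hZ hX) (mdiffAt_inner hZ' hX),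
      mlieBracket_add_right hZ hZ']
    simp [inner_add_left, inner_add_right]
    ring

open Classical in
/-- `leviCivitaFun Y x v` is `∇_v Y`, the tangent vector at `x` with `2 ⟨∇_v Y, w⟩` given by the
Koszul formula for all `w`. (If `Y` is not differentiable at `x`, the value is `0`.) -/
def leviCivitaFun (Y : Π x : M, TangentSpace I x) (x : M) :
    TangentSpace I x →L[ℝ] TangentSpace I x :=
  if hY : MDiffAt (T% Y) x then
    (1 / 2 : ℝ) • ∑ k, ((TensorialAt.mkHom₂ (I := I) (F := E) (F' := E)
      (fun X Z : Π x : M, TangentSpace I x ↦ koszul X Y Z x) x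
      (fun Z hZ ↦ koszul_tensorial_left Y Z x hY hZ)
      (fun X hX ↦ koszul_tensorial_right X Y x hX hY)).flip
        (stdOrthonormalBasis ℝ (TangentSpace I x) k)).smulRight
          (stdOrthonormalBasis ℝ (TangentSpace I x) k)
  else 0

theorem inner_leviCivitaFun {X Y Z : Π x : M, TangentSpace I x} {x : M}
    (hX : MDiffAt (T% X) x) (hY : MDiffAt (T% Y) x) (hZ : MDiffAt (T% Z) x) :
    inner ℝ (leviCivitaFun Y x (X x)) (Z x) = (1 / 2) * koszul X Y Z x := by
  set b := stdOrthonormalBasis ℝ (TangentSpace I x) with hb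
  have key := TensorialAt.mkHom₂_apply (I := I) (F := E) (F' := E)
      (Φ := fun X Z : Π x : M, TangentSpace I x ↦ koszul X Y Z x) (x := x)
      (fun Z hZ ↦ koszul_tensorial_left Y Z x hY hZ)
      (fun X hX ↦ koszul_tensorial_right X Y x hX hY) hX hZ
  rw [leviCivitaFun, dif_pos hY, ← key]
  conv_rhs => rw [← b.sum_repr (Z x)]
  simp only [map_sum, map_smul, smul_eq_mul, OrthonormalBasis.repr_apply_apply]
  simp [sum_inner, inner_smul_left, ← hb]
  exact Finset.sum_congr rfl fun k _ ↦ mul_comm _ _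


theorem koszul_add_mid {X Y Y' Z : Π x : M, TangentSpace I x} {x : M}
    (hX : MDiffAt (T% X) x) (hY : MDiffAt (T% Y) x) (hY' : MDiffAt (T% Y') x)
    (hZ : MDiffAt (T% Z) x) :
    koszul X (Y + Y') Z x = koszul X Y Z x + koszul X Y' Z x := by
  have h1 : d% (fun y ↦ inner ℝ ((Y + Y') y) (Z y)) x =
      d% (fun y ↦ inner ℝ (Y y) (Z y) + inner ℝ (Y' y) (Z y)) x := by
    congr 1; ext y; simp [inner_add_left]
  have h2 : d% (fun y ↦ inner ℝ (X y) ((Y + Y') y)) x =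
      d% (fun y ↦ inner ℝ (X y) (Y y) + inner ℝ (X y) (Y' y)) x := by
    congr 1; ext y; simp [inner_add_right]
  simp only [koszul, h1, h2, mvfderiv_fun_add (mdiffAt_inner hY hZ) (mdiffAt_inner hY' hZ),
    mvfderiv_fun_add (mdiffAt_inner hX hY) (mdiffAt_inner hX hY'),
    mlieBracket_add_left hY hY', mlieBracket_add_right hY hY']
  simp [inner_add_left, inner_add_right]
  ring

theorem koszul_smul_mid {f : M → ℝ} {X Y Z : Π x : M, TangentSpace I x} {x : M}
    (hf : MDiffAt f x) (hX : MDiffAt (T% X) x) (hY : MDiffAt (T% Y) x)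
    (hZ : MDiffAt (T% Z) x) :
    koszul X (f • Y) Z x = f x * koszul X Y Z x + 2 * (d% f x (X x) * inner ℝ (Y x) (Z x)) := by
  have h1 : d% (fun y ↦ inner ℝ ((f • Y) y) (Z y)) x =
      d% (fun y ↦ f y * inner ℝ (Y y) (Z y)) x := by
    congr 1; ext y; simp [inner_smul_left]
  have h2 : d% (fun y ↦ inner ℝ (X y) ((f • Y) y)) x =
      d% (fun y ↦ f y * inner ℝ (X y) (Y y)) x := by
    congr 1; ext y; simp [inner_smul_right]
  simp only [koszul, h1, h2, mvfderiv_fun_mul hf (mdiffAt_inner hY hZ),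
    mvfderiv_fun_mul hf (mdiffAt_inner hX hY),
    mlieBracket_smul_left hf hY, mlieBracket_smul_right hf hY]
  simp [inner_smul_left, inner_smul_right, inner_add_left, real_inner_comm]
  ring

/-- Two endomorphisms of a tangent space agree if their matrix coefficients agree. -/
theorem clm_ext_inner {x : M} {A B : TangentSpace I x →L[ℝ] TangentSpace I x}
    (h : ∀ v w : TangentSpace I x, inner ℝ (A v) w = (inner ℝ (B v) w : ℝ)) : A = B := by
  ext1 v
  exact ext_inner_right ℝ fun w ↦ h v w

variable (I M) in
/-- The Levi-Civita connection of the Riemannian manifold `M`; `leviCivita I M Y x v` is `∇_v Y`.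
It is the torsion-free connection compatible with the metric, as shown below. -/
def leviCivita : CovariantDerivative I E (fun x : M ↦ TangentSpace I x) where
  toFun := leviCivitaFun
  isCovariantDerivativeOnUniv :=
    { add := by
        intro Y Y' x hY hY' _
        refine clm_ext_inner fun v w ↦ ?_
        have hv := mdifferentiableAt_extend I E v
        have hw := mdifferentiableAt_extend I E w
        have h1 := inner_leviCivitaFun hv hY hw
        have h2 := inner_leviCivitaFun hv hY' hw
        have h3 := inner_leviCivitaFun hv (mdifferentiableAt_add_section hY hY') hw
        simp only [extend_apply_self] at h1 h2 h3
        change inner ℝ (leviCivitaFun (Y + Y') x v) w = _ at h3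
        rw [add_apply, inner_add_left, h1, h2, h3]
        change _ * koszul _ (Y + Y') _ x = _
        rw [koszul_add_mid hv hY hY' hw]
        ring
      leibniz := by
        intro Y f x hY hf _
        refine clm_ext_inner fun v w ↦ ?_
        have hv := mdifferentiableAt_extend I E v
        have hw := mdifferentiableAt_extend I E w
        have h1 := inner_leviCivitaFun hv hY hw
        have h3 := inner_leviCivitaFun hv (hf.smul_section hY) hw
        simp only [extend_apply_self] at h1 h3
        change inner ℝ (leviCivitaFun (f • Y) x v) w = _ at h3
        rw [h3]
        change _ * koszul _ (f • Y) _ x = _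
        rw [koszul_smul_mid hf hv hY hw]
        simp only [add_apply, smul_apply, inner_add_left,
          inner_smul_left, h1, ContinuousLinearMap.smulRight_apply, extend_apply_self]
        simp
        ring }

theorem leviCivita_torsion : (leviCivita I M).torsion = 0 := by
  rw [CovariantDerivative.torsion_eq_zero_iff]
  intro X Y x hX hY
  refine ext_inner_right ℝ fun w ↦ ?_
  have hw := mdifferentiableAt_extend I E w
  have h1 := inner_leviCivitaFun hX hY hw
  have h2 := inner_leviCivitaFun hY hX hw
  simp only [extend_apply_self] at h1 h2
  change inner ℝ (leviCivitaFun Y x (X x) - leviCivitaFun X x (Y x)) w = _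
  rw [inner_sub_left, h1, h2, koszul, koszul, mlieBracket_swap_apply (V := Y) (W := X)]
  simp [real_inner_comm]
  ring

theorem leviCivita_metric {X Y Z : Π x : M, TangentSpace I x} {x : M}
    (hX : MDiffAt (T% X) x) (hY : MDiffAt (T% Y) x) (hZ : MDiffAt (T% Z) x) :
    d% (fun y ↦ inner ℝ (Y y) (Z y)) x (X x) =
      inner ℝ (leviCivita I M Y x (X x)) (Z x) + inner ℝ (Y x) (leviCivita I M Z x (X x)) := by
  have h1 := inner_leviCivitaFun hX hY hZ
  have h2 := inner_leviCivitaFun hX hZ hY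
  change _ = inner ℝ (leviCivitaFun Y x (X x)) (Z x) + inner ℝ (Y x) (leviCivitaFun Z x (X x))
  rw [real_inner_comm _ (Y x), h1, h2, koszul, koszul, mlieBracket_swap_apply (V := Z) (W := Y)]
  simp [real_inner_comm]
  ring

variable (I M) in
theorem leviCivita_metricCompatible :
    CovariantDerivative.IsMetricCompatible (F := E) (V := fun x : M ↦ TangentSpace I x)
      (leviCivita I M) := by
  rw [CovariantDerivative.isMetricCompatible_iff]
  intro x X Y Z hX hY hZ
  exact leviCivita_metric hX hY hZ

/-- The curvature `R(X,Y)Z = ∇_X ∇_Y Z - ∇_Y ∇_X Z - ∇_[X,Y] Z` of vector fields. -/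
def curvature (X Y Z : Π x : M, TangentSpace I x) (x : M) : TangentSpace I x :=
  leviCivita I M (fun y ↦ leviCivita I M Z y (Y y)) x (X x)
    - leviCivita I M (fun y ↦ leviCivita I M Z y (X y)) x (Y x)
    - leviCivita I M Z x (mlieBracket I X Y x)

/-- The curvature tensor `R(u,v,w,z) = ⟨R(u,v)w, z⟩` on tangent vectors at `x`, computed by
extending `u`, `v`, `w` to vector fields that are smooth near `x`. -/
def curvatureTensor {x : M} (u v w z : TangentSpace I x) : ℝ :=
  inner ℝ (curvature (extend E u) (extend E v) (extend E w) x) z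

section Components

variable {x : M} {m : ℕ} (e : OrthonormalBasis (Fin m) ℝ (TangentSpace I x))

/-- The components `R_abcd = ⟨R(e_a,e_b)e_c, e_d⟩`. -/
def Rm (a b c d : Fin m) : ℝ := curvatureTensor (e a) (e b) (e c) (e d)

/-- The components `g_ij = ⟨e_i, e_j⟩` of the metric. -/
def metricComp (i j : Fin m) : ℝ := inner ℝ (e i) (e j)

/-- The Ricci tensor `ρ_ij = ∑ R_aija`. -/
def ricci (i j : Fin m) : ℝ := ∑ a, Rm e a i j a

/-- The scalar curvature `τ = ∑ ρ_ii`. -/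
def scalarCurvature : ℝ := ∑ i, ricci e i i

/-- `|R|² = ∑ R_abcd R_abcd`. -/
def RmNormSq : ℝ := ∑ a, ∑ b, ∑ c, ∑ d, Rm e a b c d ^ 2

/-- The scalar `R̂ = ∑ R_abcd R_abuv R_cduv`. -/
def hatR : ℝ :=
  ∑ a, ∑ b, ∑ c, ∑ d, ∑ u, ∑ v, Rm e a b c d * Rm e a b u v * Rm e c d u v

/-- The scalar `R̊ = ∑ R_abcd R_aucv R_budv`. -/
def ringR : ℝ :=
  ∑ a, ∑ b, ∑ c, ∑ d, ∑ u, ∑ v, Rm e a b c d * Rm e a u c v * Rm e b u d v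

/-- The tensor `Ř_ij = ∑ R_iuvj R_abcu R_abcv`. -/
def checkTensor (i j : Fin m) : ℝ :=
  ∑ u, ∑ v, ∑ a, ∑ b, ∑ c, Rm e i u v j * Rm e a b c u * Rm e a b c v

/-- The tensor `R̂_ij = ∑ R_ibac R_jbuv R_acuv`. -/
def hatTensor (i j : Fin m) : ℝ :=
  ∑ a, ∑ b, ∑ c, ∑ u, ∑ v, Rm e i b a c * Rm e j b u v * Rm e a c u v

/-- The tensor `R̊_ij = ∑ R_iabc R_jubv R_aucv`. -/
def ringTensor (i j : Fin m) : ℝ :=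
  ∑ a, ∑ b, ∑ c, ∑ u, ∑ v, Rm e i a b c * Rm e j u b v * Rm e a u c v

/-- The tensor `∑ R_iabc R_jabc`. -/
def RmSqTensor (i j : Fin m) : ℝ := ∑ a, ∑ b, ∑ c, Rm e i a b c * Rm e j a b c

end Components

variable (I M) in
/-- `M` is an Einstein manifold: `ρ = (τ / m) g`, where `m` is the dimension of `M`. -/
def IsEinstein : Prop :=
  ∀ (x : M) (m : ℕ) (e : OrthonormalBasis (Fin m) ℝ (TangentSpace I x)) (i j : Fin m),
    ricci e i j = scalarCurvature e / m * metricComp e i j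

end RiemannianCurvature

end

/-!
The identity is algebraic: it holds for every algebraic curvature tensor in dimension six whose Ricci
tensor is a multiple of the metric. It has the same origin as the vanishing of the Lovelock tensor of
order three in dimension six.

Antisymmetrizing a product of three curvature factors over the six indices in their second pairs
gives a function `wedgeCube` that is alternating in six indices. In dimension six, alternating over
a seventh index gives zero (`schouten_identity`). Contracting this relation shows that the tensor
`Q` obtained from `wedgeCube` by contracting five pairs of indices satisfies `6 Q_ij = (tr Q) g_ij`
(`six_mul_cubeContraction`). For an Einstein tensor with Ricci tensor `l g`, expanding `Q` gives `Q
= (-4 l³ - l |R|²) g + 4 Ř + 8 l R_iabc R_jabc + 4 R̂ - 8 R̊` (`cubeContraction_eq`), and the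
relation becomes the identity of the theorem (`curvature_identity`).

It remains to know that the components of the Riemann tensor have the symmetries of an algebraic
curvature tensor. Antisymmetry in the last two indices needs `[X, Y] f = X (Y f) - Y (X f)`, and the
Bianchi identity needs the Jacobi identity. Both also need that `∇_Y Z` is differentiable when `Y` and
`Z` are `C^2` (`mdiffAt_leviCivita`); this follows from the Koszul formula, since a vector field is
determined by its inner products with a local frame.
-/

noncomputable section

namespace RiemannianCurvature

open Filter Topology

section Connection

set_option linter.unusedSectionVars false

variable {E : Type*} [NormedAddCommGroup E] [NormedSpace ℝ E] [FiniteDimensional ℝ E]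
  {H : Type*} [TopologicalSpace H] {I : ModelWithCorners ℝ E H}
  {M : Type*} [TopologicalSpace M] [ChartedSpace H M] [IsManifold I ∞ M]
  [RiemannianBundle (fun x : M ↦ TangentSpace I x)]
  [IsContMDiffRiemannianBundle I ∞ E (fun x : M ↦ TangentSpace I x)]

/-! ### Smoothness of vector fields and directional derivatives -/

theorem contMDiffAt_det {ι : Type*} [Fintype ι] [DecidableEq ι] {A : M → Matrix ι ι ℝ} {x : M}
    (hA : ∀ k l, CMDiffAt 1 (fun y ↦ A y k l) x) : CMDiffAt 1 (fun y ↦ (A y).det) x := by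
  simp only [Matrix.det_apply']
  exact contMDiffAt_finsetSum fun σ _ ↦
    contMDiffAt_const.mul (contMDiffAt_finsetProd fun k _ ↦ hA _ _)

theorem contMDiffAt_inv_apply {ι : Type*} [Fintype ι] [DecidableEq ι] {A : M → Matrix ι ι ℝ}
    {x : M} (hA : ∀ k l, CMDiffAt 1 (fun y ↦ A y k l) x) (hx : (A x).det ≠ 0) (k l : ι) :
    CMDiffAt 1 (fun y ↦ (A y)⁻¹ k l) x := by
  simp only [Matrix.inv_def, Matrix.smul_apply, Ring.inverse_eq_inv', smul_eq_mul,
    Matrix.adjugate_apply]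
  refine ((contMDiffAt_det hA).inv₀ hx).mul (contMDiffAt_det fun p q ↦ ?_)
  by_cases hp : p = l
  · subst hp; simp only [Matrix.updateRow_self]; exact contMDiffAt_const
  · simp only [Matrix.updateRow_ne hp]; exact hA p q

theorem eventually_contMDiffAt {X : Π x : M, TangentSpace I x} {x : M}
    (hX : CMDiffAt 2 (T% X) x) : ∀ᶠ y in 𝓝 x, CMDiffAt 2 (T% X) y :=
  (contMDiffAt_iff_contMDiffAt_nhds (by simp)).1 hX

theorem contMDiffAt_extend_two {x : M} (v : TangentSpace I x) : CMDiffAt 2 (T% (extend E v)) x :=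
  contMDiffAt_extend I E v

/-- A vector field is differentiable at `x` as soon as its inner products with all `C^2` vector fields
are `C^1`: its coefficients in a local frame are these inner products multiplied by the inverse of
the Gram matrix of the frame. -/
theorem mdiffAt_of_inner {s : Π x : M, TangentSpace I x} {x : M}
    (hs : ∀ W : Π x : M, TangentSpace I x, CMDiffAt 2 (T% W) x →
      CMDiffAt 1 (fun y ↦ (inner ℝ (s y) (W y) : ℝ)) x) : MDiffAt (T% s) x := by
  classical
  set b := Module.finBasis ℝ E
  set t := trivializationAt E (fun x : M ↦ TangentSpace I x) x
  have hx : x ∈ t.baseSet := mem_baseSet_trivializationAt E _ x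
  have hloc := t.isLocalFrameOn_localFrame_baseSet I 1 b
  set W := t.localFrame b
  have hW : ∀ k, CMDiffAt 2 (T% (W k)) x := fun k ↦ contMDiffAt_localFrame_of_mem 2 t b k hx
  set G : M → Matrix _ _ ℝ := fun y ↦ Matrix.gram ℝ fun k ↦ W k y with hGdef
  have hG : ∀ k l, CMDiffAt 1 (fun y ↦ G y k l) x := fun k l ↦
    ContMDiffAt.inner_bundle (F := E) (E := fun x : M ↦ TangentSpace I x)
      ((hW k).of_le one_le_two) ((hW l).of_le one_le_two)
  have hdet : ∀ y ∈ t.baseSet, (G y).det ≠ 0 := fun y hy ↦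
    (Matrix.posDef_gram_of_linearIndependent (𝕜 := ℝ) (hloc.linearIndependent hy)).det_pos.ne'
  have hcoeff : ∀ k, ∀ y ∈ t.baseSet, hloc.coeff k y (s y) =
      ∑ l, inner ℝ (s y) (W l y) * (G y)⁻¹ l k := by
    intro k y hy
    have h1 : ∀ l, inner ℝ (s y) (W l y) =
        Matrix.vecMul (fun k ↦ hloc.coeff k y (s y)) (G y) l := by
      intro l
      conv_lhs => rw [hloc.coeff_sum_eq s hy]
      simp only [sum_inner, inner_smul_left, Matrix.vecMul, dotProduct, hGdef, Matrix.gram_apply]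
      rfl
    have h2 := congrFun (Matrix.vecMul_vecMul (fun k ↦ hloc.coeff k y (s y)) (G y) (G y)⁻¹) k
    rw [Matrix.mul_nonsing_inv _ (hdet y hy).isUnit, Matrix.vecMul_one] at h2
    rw [← h2]
    simp only [h1]
    rfl
  refine hloc.mdifferentiableAt_of_coeff (fun k ↦ ?_) (t.open_baseSet.mem_nhds hx)
  have h3 : CMDiffAt 1 (fun y ↦ ∑ l, inner ℝ (s y) (W l y) * (G y)⁻¹ l k) x :=
    contMDiffAt_finsetSum fun l _ ↦
      (hs _ (hW l)).mul (contMDiffAt_inv_apply hG (hdet x hx) l k)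
  refine (h3.mdifferentiableAt one_ne_zero).congr_of_eventuallyEq ?_
  filter_upwards [t.open_baseSet.mem_nhds hx] with y hy
  exact hcoeff k y hy

/-- The derivative `Y f` can be read off from Lie brackets. This transfers statements on Lie brackets
to directional derivatives of functions, without a computation in charts. -/
theorem dirDeriv_smul_eq {f : M → ℝ} {Y Z : Π x : M, TangentSpace I x} {y : M}
    (hf : MDiffAt f y) (hZ : MDiffAt (T% Z) y) :
    d% f y (Y y) • Z y = mlieBracket I Y (f • Z) y - f y • mlieBracket I Y Z y := by
  rw [mlieBracket_smul_right hf hZ]; abel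

theorem contMDiffAt_inner {n : ℕ∞ω} [ENat.LEInfty n] {X Y : Π x : M, TangentSpace I x} {x : M}
    (hX : CMDiffAt n (T% X) x) (hY : CMDiffAt n (T% Y) x) :
    CMDiffAt n (fun y ↦ (inner ℝ (X y) (Y y) : ℝ)) x :=
  ContMDiffAt.inner_bundle (F := E) (E := fun x : M ↦ TangentSpace I x) hX hY

theorem contMDiffAt_mlieBracket {X Y : Π x : M, TangentSpace I x} {x : M}
    (hX : CMDiffAt 2 (T% X) x) (hY : CMDiffAt 2 (T% Y) x) :
    CMDiffAt 1 (T% (mlieBracket I X Y)) x := by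
  have : CompleteSpace E := FiniteDimensional.complete ℝ E
  have : IsManifold I ((2 : ℕ∞) + 1) M := .of_le (n := ∞) (by norm_cast)
  have : IsManifold I (minSmoothness ℝ 2) M := .of_le (n := ∞) (by simp; norm_cast)
  exact ContMDiffAt.mlieBracket_vectorField (m := 1) (n := 2) hX hY (by simp; norm_num)

/-- The directional derivative `Y f` is `C^1`: with a vector field `Z` that does not vanish near `x`,
it is the quotient of `⟨[Y, f Z] - f [Y, Z], Z⟩` by `⟨Z, Z⟩`. -/
theorem contMDiffAt_dirDeriv {f : M → ℝ} {Y : Π x : M, TangentSpace I x} {x : M}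
    (hf : CMDiffAt 2 f x) (hY : CMDiffAt 2 (T% Y) x) :
    CMDiffAt 1 (fun y ↦ d% f y (Y y)) x := by
  rcases subsingleton_or_nontrivial E with hE | hE
  · have : (fun y ↦ d% f y (Y y)) = fun _ ↦ 0 := by
      ext y
      have : Y y = 0 := Subsingleton.elim (α := E) _ _
      rw [this, map_zero]
    rw [this]; exact contMDiffAt_const
  have : Nontrivial (TangentSpace I x) := hE
  obtain ⟨z, hz⟩ := exists_ne (0 : TangentSpace I x)
  set Z := extend E z with hZdef
  have hZ : CMDiffAt 2 (T% Z) x := contMDiffAt_extend_two _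
  have hZx : (inner ℝ (Z x) (Z x) : ℝ) ≠ 0 := by
    rw [hZdef, extend_apply_self]; exact inner_self_ne_zero.2 hz
  have hZZ := contMDiffAt_inner hZ hZ
  have key : CMDiffAt 1 (fun y ↦ (inner ℝ (mlieBracket I Y (f • Z) y) (Z y)
      - f y * inner ℝ (mlieBracket I Y Z y) (Z y)) / inner ℝ (Z y) (Z y)) x :=
    ((contMDiffAt_inner (contMDiffAt_mlieBracket hY (hf.smul_section hZ))
      (hZ.of_le one_le_two)).sub ((hf.of_le one_le_two).mul (contMDiffAt_inner
        (contMDiffAt_mlieBracket hY hZ) (hZ.of_le one_le_two)))).div₀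
      (hZZ.of_le one_le_two) hZx
  refine key.congr_of_eventuallyEq ?_
  filter_upwards [eventually_contMDiffAt hZ, (contMDiffAt_iff_contMDiffAt_nhds (by simp)).1 hf,
    hZZ.continuousAt.eventually_ne hZx] with y hy1 hy2 hy3
  rw [eq_div_iff hy3, ← real_inner_smul_left, ← real_inner_smul_left, ← inner_sub_left,
    ← dirDeriv_smul_eq (hy2.mdifferentiableAt two_ne_zero) (hy1.mdifferentiableAt two_ne_zero)]

/-- `[X, Y] f = X (Y f) - Y (X f)`. This is the Jacobi identity for `X`, `Y` and `f Z`, where `Z` is a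
vector field with `Z x ≠ 0`, minus `f` times the one for `X`, `Y` and `Z`. -/
theorem dirDeriv_mlieBracket {f : M → ℝ} {X Y : Π x : M, TangentSpace I x} {x : M}
    (hf : CMDiffAt 2 f x) (hX : CMDiffAt 2 (T% X) x) (hY : CMDiffAt 2 (T% Y) x) :
    d% f x (mlieBracket I X Y x) =
      d% (fun y ↦ d% f y (Y y)) x (X x) - d% (fun y ↦ d% f y (X y)) x (Y x) := by
  have : CompleteSpace E := FiniteDimensional.complete ℝ E
  rcases subsingleton_or_nontrivial E with hE | hE
  · have h0 : ∀ v : TangentSpace I x, v = 0 := fun v ↦ Subsingleton.elim (α := E) _ _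
    rw [h0 (X x), h0 (Y x), h0 (mlieBracket I X Y x)]; simp
  have : Nontrivial (TangentSpace I x) := hE
  obtain ⟨z, hz⟩ := exists_ne (0 : TangentSpace I x)
  set Z := extend E z with hZdef
  have hZx : Z x ≠ 0 := by rw [hZdef, extend_apply_self]; exact hz
  have hZ : CMDiffAt 2 (T% Z) x := contMDiffAt_extend_two _
  have hfev := (contMDiffAt_iff_contMDiffAt_nhds (by simp)).1 hf
  have hf1 := hf.mdifferentiableAt two_ne_zero
  have hbr : ∀ {V : Π x : M, TangentSpace I x}, CMDiffAt 2 (T% V) x →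
      mlieBracket I V (f • Z) =ᶠ[𝓝 x] (fun y ↦ d% f y (V y)) • Z + f • mlieBracket I V Z := by
    intro V hV
    filter_upwards [eventually_contMDiffAt hZ, hfev] with y hy1 hy2
    exact mlieBracket_smul_right (hy2.mdifferentiableAt two_ne_zero)
      (hy1.mdifferentiableAt two_ne_zero)
  have hmd : ∀ {V : Π x : M, TangentSpace I x}, CMDiffAt 2 (T% V) x → MDiffAt (T% V) x :=
    fun hV ↦ hV.mdifferentiableAt two_ne_zero
  have hmb : ∀ {V W : Π x : M, TangentSpace I x}, CMDiffAt 2 (T% V) x → CMDiffAt 2 (T% W) x →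
      MDiffAt (T% (mlieBracket I V W)) x := fun hV hW ↦
    (contMDiffAt_mlieBracket hV hW).mdifferentiableAt one_ne_zero
  have hdd : ∀ {V : Π x : M, TangentSpace I x}, CMDiffAt 2 (T% V) x →
      MDiffAt (fun y ↦ d% f y (V y)) x := fun hV ↦
    (contMDiffAt_dirDeriv hf hV).mdifferentiableAt one_ne_zero
  -- the Leibniz rule, applied twice to `[U, [V, f Z]]`
  have h2 : ∀ {U V : Π x : M, TangentSpace I x}, CMDiffAt 2 (T% U) x → CMDiffAt 2 (T% V) x →
      mlieBracket I U (mlieBracket I V (f • Z)) x =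
        d% (fun y ↦ d% f y (V y)) x (U x) • Z x + d% f x (V x) • mlieBracket I U Z x
          + (d% f x (U x) • mlieBracket I V Z x
            + f x • mlieBracket I U (mlieBracket I V Z) x) := by
    intro U V hU hV
    rw [(EventuallyEq.refl _ U).mlieBracket_vectorField_eq (hbr hV),
      mlieBracket_add_right ((hdd hV).smul_section (hmd hZ)) (hf1.smul_section (hmb hV hZ)),
      mlieBracket_smul_right (hdd hV) (hmd hZ), mlieBracket_smul_right hf1 (hmb hV hZ)]
  have hms : minSmoothness ℝ 2 = 2 := by simp
  have hms3 : minSmoothness ℝ 3 = 3 := by simp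
  have : IsManifold I (minSmoothness ℝ 3) M := .of_le (n := ∞) (by rw [hms3]; norm_cast)
  have j1 := leibniz_identity_mlieBracket_apply (U := X) (V := Y) (W := f • Z) (x := x)
    (by rwa [hms]) (by rwa [hms]) (by rw [hms]; exact hf.smul_section hZ)
  have j2 := leibniz_identity_mlieBracket_apply (U := X) (V := Y) (W := Z) (x := x)
    (by rwa [hms]) (by rwa [hms]) (by rwa [hms])
  rw [h2 hX hY, h2 hY hX, mlieBracket_smul_right hf1 (hmd hZ), j2] at j1
  have h3 : (d% f x (mlieBracket I X Y x) - (d% (fun y ↦ d% f y (Y y)) x (X x)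
      - d% (fun y ↦ d% f y (X y)) x (Y x))) • Z x = 0 := by
    rw [sub_smul, sub_smul, sub_eq_zero]
    rw [smul_add] at j1
    rw [← sub_eq_zero] at j1 ⊢
    rw [← neg_eq_zero, ← j1]
    abel
  exact sub_eq_zero.1 ((smul_eq_zero.1 h3).resolve_right hZx)

/-! ### Symmetries of the curvature tensor -/

/-- `∇_Y Z` is differentiable, because the Koszul formula expresses its inner products with vector
fields through first derivatives. -/
theorem mdiffAt_leviCivita {Y Z : Π x : M, TangentSpace I x} {x : M}
    (hY : CMDiffAt 2 (T% Y) x) (hZ : CMDiffAt 2 (T% Z) x) :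
    MDiffAt (T% (fun y ↦ leviCivita I M Z y (Y y))) x := by
  refine mdiffAt_of_inner fun W hW ↦ ?_
  have h1 : ∀ {V : Π x : M, TangentSpace I x}, CMDiffAt 2 (T% V) x → CMDiffAt 1 (T% V) x :=
    fun hV ↦ hV.of_le one_le_two
  have key : CMDiffAt 1 (fun y ↦ (1 / 2) * koszul Y Z W y) x := by
    refine contMDiffAt_const.mul ?_
    exact (((((contMDiffAt_dirDeriv (contMDiffAt_inner hZ hW) hY).add
      (contMDiffAt_dirDeriv (contMDiffAt_inner hW hY) hZ)).sub
      (contMDiffAt_dirDeriv (contMDiffAt_inner hY hZ) hW)).add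
      (contMDiffAt_inner (contMDiffAt_mlieBracket hY hZ) (h1 hW))).sub
      (contMDiffAt_inner (contMDiffAt_mlieBracket hY hW) (h1 hZ))).sub
      (contMDiffAt_inner (contMDiffAt_mlieBracket hZ hW) (h1 hY))
  refine key.congr_of_eventuallyEq ?_
  filter_upwards [eventually_contMDiffAt hY, eventually_contMDiffAt hZ,
    eventually_contMDiffAt hW] with y h1 h2 h3
  exact inner_leviCivitaFun (h1.mdifferentiableAt two_ne_zero)
    (h2.mdifferentiableAt two_ne_zero) (h3.mdifferentiableAt two_ne_zero)

theorem leviCivita_sub_eq_mlieBracket {X Y : Π x : M, TangentSpace I x} {x : M}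
    (hX : MDiffAt (T% X) x) (hY : MDiffAt (T% Y) x) :
    leviCivita I M Y x (X x) - leviCivita I M X x (Y x) = mlieBracket I X Y x :=
  (CovariantDerivative.torsion_eq_zero_iff _).1 leviCivita_torsion hX hY

theorem curvature_swap (X Y Z : Π x : M, TangentSpace I x) (x : M) :
    curvature X Y Z x = -curvature Y X Z x := by
  simp only [curvature]
  rw [mlieBracket_swap_apply (V := X), map_neg]
  abel

theorem leviCivita_leviCivita_sub {X Y Z : Π x : M, TangentSpace I x} {x : M}
    (hY : CMDiffAt 2 (T% Y) x) (hZ : CMDiffAt 2 (T% Z) x) :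
    leviCivita I M (fun y ↦ leviCivita I M Z y (Y y)) x (X x)
      - leviCivita I M (fun y ↦ leviCivita I M Y y (Z y)) x (X x)
      = leviCivita I M (mlieBracket I Y Z) x (X x) := by
  have hYZ := (contMDiffAt_mlieBracket hY hZ).mdifferentiableAt one_ne_zero
  have hZY := mdiffAt_leviCivita hZ hY
  have h := (leviCivita I M).isCovariantDerivativeOnUniv.add hZY hYZ
  have hc := (leviCivita I M).isCovariantDerivativeOnUniv.congr_of_eventuallyEq
    (σ := fun y ↦ leviCivita I M Z y (Y y))
    (σ' := (fun y ↦ leviCivita I M Y y (Z y)) + mlieBracket I Y Z)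
    (mdiffAt_leviCivita hY hZ) (mdifferentiableAt_add_section hZY hYZ) univ_mem (by
      filter_upwards [eventually_contMDiffAt hY, eventually_contMDiffAt hZ] with y h1 h2
      rw [Pi.add_apply, ← leviCivita_sub_eq_mlieBracket (h1.mdifferentiableAt two_ne_zero)
        (h2.mdifferentiableAt two_ne_zero)]
      abel)
  rw [hc, h, add_apply]
  abel

/-- The first Bianchi identity: as the connection is torsion-free, the cyclic sum reduces to the
Jacobi identity. -/
theorem curvature_bianchi {X Y Z : Π x : M, TangentSpace I x} {x : M}
    (hX : CMDiffAt 2 (T% X) x) (hY : CMDiffAt 2 (T% Y) x) (hZ : CMDiffAt 2 (T% Z) x) :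
    curvature X Y Z x + curvature Y Z X x + curvature Z X Y x = 0 := by
  have : CompleteSpace E := FiniteDimensional.complete ℝ E
  have hms : minSmoothness ℝ 2 = 2 := by simp
  have hms3 : minSmoothness ℝ 3 = 3 := by simp
  have : IsManifold I (minSmoothness ℝ 2) M := .of_le (n := ∞) (by simp; norm_cast)
  have : IsManifold I (minSmoothness ℝ 3) M := .of_le (n := ∞) (by rw [hms3]; norm_cast)
  have j := leibniz_identity_mlieBracket_apply (U := X) (V := Y) (W := Z) (x := x)
    (by rwa [hms]) (by rwa [hms]) (by rwa [hms])
  have hmd : ∀ {V : Π x : M, TangentSpace I x}, CMDiffAt 2 (T% V) x → MDiffAt (T% V) x :=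
    fun hV ↦ hV.mdifferentiableAt two_ne_zero
  have hmb : ∀ {V W : Π x : M, TangentSpace I x}, CMDiffAt 2 (T% V) x → CMDiffAt 2 (T% W) x →
      MDiffAt (T% (mlieBracket I V W)) x := fun hV hW ↦
    (contMDiffAt_mlieBracket hV hW).mdifferentiableAt one_ne_zero
  have a1 := leviCivita_leviCivita_sub (X := X) hY hZ
  have a2 := leviCivita_leviCivita_sub (X := Y) hZ hX
  have a3 := leviCivita_leviCivita_sub (X := Z) hX hY
  have b1 := leviCivita_sub_eq_mlieBracket (hmd hX) (hmb hY hZ)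
  have b2 := leviCivita_sub_eq_mlieBracket (hmd hY) (hmb hZ hX)
  have b3 := leviCivita_sub_eq_mlieBracket (hmd hZ) (hmb hX hY)
  have c2 : mlieBracket I Y (mlieBracket I Z X) x = -mlieBracket I Y (mlieBracket I X Z) x := by
    rw [mlieBracket_swap (V := Z) (W := X)]
    have := mlieBracket_const_smul_right (V := Y) (c := (-1 : ℝ)) (hmb hX hZ)
    simpa using this
  have c3 : mlieBracket I Z (mlieBracket I X Y) x = -mlieBracket I (mlieBracket I X Y) Z x :=
    mlieBracket_swap_apply
  simp only [curvature]
  rw [c2] at b2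
  rw [c3] at b3
  rw [← a1] at b1
  rw [← a2] at b2
  rw [← a3] at b3
  have h0 := congrArg₂ (· + ·) (congrArg₂ (· + ·) b1 b2) b3
  simp only [j] at h0
  have h1 : mlieBracket I (mlieBracket I X Y) Z x + mlieBracket I Y (mlieBracket I X Z) x
      + -mlieBracket I Y (mlieBracket I X Z) x + -mlieBracket I (mlieBracket I X Y) Z x = 0 := by
    abel
  rw [h1] at h0
  rw [← h0]
  abel

/-- Metric compatibility, applied twice to `X (Y ⟨Z, W⟩)`. -/
theorem dirDeriv_dirDeriv_inner {X Y Z W : Π x : M, TangentSpace I x} {x : M}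
    (hX : CMDiffAt 2 (T% X) x) (hY : CMDiffAt 2 (T% Y) x) (hZ : CMDiffAt 2 (T% Z) x)
    (hW : CMDiffAt 2 (T% W) x) :
    d% (fun y ↦ d% (fun p ↦ (inner ℝ (Z p) (W p) : ℝ)) y (Y y)) x (X x) =
      inner ℝ (leviCivita I M (fun y ↦ leviCivita I M Z y (Y y)) x (X x)) (W x)
        + inner ℝ (leviCivita I M Z x (Y x)) (leviCivita I M W x (X x))
        + (inner ℝ (leviCivita I M Z x (X x)) (leviCivita I M W x (Y x))
        + inner ℝ (Z x) (leviCivita I M (fun y ↦ leviCivita I M W y (Y y)) x (X x))) := by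
  have hmd : ∀ {V : Π x : M, TangentSpace I x}, CMDiffAt 2 (T% V) x → MDiffAt (T% V) x :=
    fun hV ↦ hV.mdifferentiableAt two_ne_zero
  have hev : (fun y ↦ d% (fun p ↦ (inner ℝ (Z p) (W p) : ℝ)) y (Y y)) =ᶠ[𝓝 x]
      (fun y ↦ inner ℝ (leviCivita I M Z y (Y y)) (W y))
        + fun y ↦ inner ℝ (Z y) (leviCivita I M W y (Y y)) := by
    filter_upwards [eventually_contMDiffAt hY, eventually_contMDiffAt hZ,
      eventually_contMDiffAt hW] with y h1 h2 h3
    exact leviCivita_metric (h1.mdifferentiableAt two_ne_zero)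
      (h2.mdifferentiableAt two_ne_zero) (h3.mdifferentiableAt two_ne_zero)
  have hZY := mdiffAt_leviCivita hY hZ
  have hWY := mdiffAt_leviCivita hY hW
  have h1 := leviCivita_metric (hmd hX) hZY (hmd hW)
  have h2 := leviCivita_metric (hmd hX) (hmd hZ) hWY
  rw [← h1, ← h2, ← add_apply, ← mvfderiv_add (mdiffAt_inner hZY (hmd hW))
    (mdiffAt_inner (hmd hZ) hWY)]
  -- `d%` is the manifold derivative, up to the identification of the tangent spaces of `ℝ` with `ℝ`
  exact congrArg (fun L : E →L[ℝ] ℝ ↦ L (X x)) hev.mfderiv_eq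

/-- The curvature operator is skew-adjoint: it annihilates the function `⟨Z, W⟩`. -/
theorem inner_curvature_antisymm {X Y Z W : Π x : M, TangentSpace I x} {x : M}
    (hX : CMDiffAt 2 (T% X) x) (hY : CMDiffAt 2 (T% Y) x) (hZ : CMDiffAt 2 (T% Z) x)
    (hW : CMDiffAt 2 (T% W) x) :
    (inner ℝ (curvature X Y Z x) (W x) : ℝ) = -inner ℝ (curvature X Y W x) (Z x) := by
  have h1 := dirDeriv_mlieBracket (contMDiffAt_inner hZ hW) hX hY
  rw [dirDeriv_dirDeriv_inner hX hY hZ hW, dirDeriv_dirDeriv_inner hY hX hZ hW,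
    leviCivita_metric ((contMDiffAt_mlieBracket hX hY).mdifferentiableAt one_ne_zero)
    (hZ.mdifferentiableAt two_ne_zero) (hW.mdifferentiableAt two_ne_zero)] at h1
  simp only [curvature, inner_sub_left]
  simp only [real_inner_comm (Z x)]
  linarith

section Components

variable {x : M} {m : ℕ} (e : OrthonormalBasis (Fin m) ℝ (TangentSpace I x))

theorem Rm_swap_left (a b c d : Fin m) : Rm e a b c d = -Rm e b a c d := by
  simp only [Rm, curvatureTensor]
  rw [curvature_swap, inner_neg_left]

theorem Rm_swap_right (a b c d : Fin m) : Rm e a b c d = -Rm e a b d c := by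
  have h := inner_curvature_antisymm (contMDiffAt_extend_two (I := I) (e a))
    (contMDiffAt_extend_two (e b)) (contMDiffAt_extend_two (e c)) (contMDiffAt_extend_two (e d))
  simp only [extend_apply_self] at h
  exact h

theorem Rm_bianchi (a b c d : Fin m) : Rm e a b c d + Rm e b c a d + Rm e c a b d = 0 := by
  simp only [Rm, curvatureTensor]
  rw [← inner_add_left, ← inner_add_left, curvature_bianchi (contMDiffAt_extend_two (e a))
    (contMDiffAt_extend_two (e b)) (contMDiffAt_extend_two (e c)), inner_zero_left]

end Components

end Connection

/-! ### The Schouten identity -/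

section Alternating

theorem alternating_of_adjacent {n : ℕ} {α : Type*} {F : (Fin (n + 1) → α) → ℝ}
    (hF : ∀ (k : Fin n) (b : Fin (n + 1) → α),
      F (b ∘ Equiv.swap k.castSucc k.succ) = -F b)
    (σ : Equiv.Perm (Fin (n + 1))) (b : Fin (n + 1) → α) :
    F (b ∘ σ) = (Equiv.Perm.sign σ : ℤ) * F b := by
  have hσ : σ ∈ Submonoid.closure
      (Set.range fun k : Fin n ↦ Equiv.swap k.castSucc k.succ) := by
    rw [Equiv.Perm.mclosure_swap_castSucc_succ]; trivial
  induction hσ using Submonoid.closure_induction generalizing b with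
  | mem σ h =>
    obtain ⟨k, rfl⟩ := h
    rw [hF, Equiv.Perm.sign_swap (Fin.castSucc_lt_succ (i := k)).ne]
    simp
  | one => simp
  | mul σ τ _ _ hσ hτ =>
    rw [Equiv.Perm.coe_mul, ← Function.comp_assoc, hτ, hσ, Equiv.Perm.sign_mul]
    push_cast; ring

/-- The Schouten identity: an alternating function `F` of `n` indices in dimension `n` satisfies
`g_ij F(b₁, …, bₙ) = ∑ₖ g_{i bₖ} F(b₁, …, j, …, bₙ)`, with `j` in position `k`. It expresses that
alternating over `n + 1` indices gives zero. -/
theorem schouten_identity {n : ℕ} {F : (Fin n → Fin n) → ℝ}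
    (hF : ∀ (σ : Equiv.Perm (Fin n)) (b : Fin n → Fin n),
      F (b ∘ σ) = (Equiv.Perm.sign σ : ℤ) * F b) (b : Fin n → Fin n) (i j : Fin n) :
    (if i = j then F b else 0) = ∑ k, if b k = i then F (Function.update b k j) else 0 := by
  have hswap : ∀ {p q : Fin n} (b : Fin n → Fin n), p ≠ q →
      F (b ∘ Equiv.swap p q) = -F b := by
    intro p q b hpq
    rw [hF, Equiv.Perm.sign_swap hpq]; simp
  have hzero : ∀ {p q : Fin n} {b : Fin n → Fin n}, p ≠ q → b p = b q → F b = 0 := by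
    intro p q b hpq hb
    have h : b ∘ Equiv.swap p q = b := by
      ext x
      rcases eq_or_ne x p with rfl | hp
      · simp [hb]
      rcases eq_or_ne x q with rfl | hq
      · simp [hb]
      · simp [Equiv.swap_apply_of_ne_of_ne hp hq]
    have := hswap b hpq
    rw [h] at this
    linarith
  -- if `b` is a permutation, only the position `k` of `i` contributes; otherwise the contributions of
  -- two positions with equal indices cancel
  by_cases hb : Function.Injective b
  · obtain ⟨k, rfl⟩ := (Finite.injective_iff_surjective.1 hb) i
    rw [Finset.sum_eq_single k (fun l _ hl ↦ if_neg fun h ↦ hl (hb h)) (by simp), if_pos rfl]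
    split_ifs with hj
    · rw [← hj, Function.update_eq_self]
    · obtain ⟨l, rfl⟩ := (Finite.injective_iff_surjective.1 hb) j
      have hlk : l ≠ k := fun h ↦ hj (by rw [h])
      exact (hzero hlk (by simp [hlk])).symm
  · obtain ⟨p, q, hbpq, hpq⟩ := Function.not_injective_iff.1 hb
    rw [hzero hpq hbpq, ite_self, ← Finset.add_sum_erase _ _ (Finset.mem_univ p),
      ← Finset.add_sum_erase _ _ (Finset.mem_erase.2 ⟨hpq.symm, Finset.mem_univ q⟩),
      Finset.sum_eq_zero (s := (Finset.univ.erase p).erase q), hbpq]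
    · have h : Function.update b p j ∘ Equiv.swap p q = Function.update b q j := by
        ext x
        rcases eq_or_ne x p with rfl | hp
        · simp [hpq, hpq.symm, hbpq]
        rcases eq_or_ne x q with rfl | hq
        · simp
        · simp [Equiv.swap_apply_of_ne_of_ne hp hq, hp, hq]
      have := hswap (Function.update b p j) hpq
      rw [h] at this
      split_ifs
      · rw [this]; ring
      · ring
    · intro k hk
      simp only [Finset.mem_erase, Finset.mem_univ, and_true] at hk
      rw [hzero hpq (b := Function.update b k j) (by simp [hk.1.symm, hk.2.symm, hbpq]), ite_self]

end Alternating

/-! ### Alternating products of curvature tensors -/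

section Algebraic

variable {ι : Type*} (R : ι → ι → ι → ι → ℝ)

/-- An algebraic curvature tensor: the algebraic symmetries of the curvature of a torsion-free metric
connection. The pair symmetry follows from them. -/
structure IsAlgebraicCurvature : Prop where
  swap_left : ∀ a b c d, R a b c d = -R b a c d
  swap_right : ∀ a b c d, R a b c d = -R a b d c
  bianchi : ∀ a b c d, R a b c d + R b c a d + R c a b d = 0

variable {R} in
theorem IsAlgebraicCurvature.pair_symm (h : IsAlgebraicCurvature R) (a b c d : ι) :
    R a b c d = R c d a b := by
  have h1 := h.bianchi a b c d
  have h2 := h.bianchi b c d a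
  have h3 := h.bianchi c d a b
  have h4 := h.bianchi d a b c
  linarith [h.swap_right a b c d, h.swap_right b c a d, h.swap_right c a b d, h.swap_right b c d a,
    h.swap_right c d b a, h.swap_right d b c a, h.swap_right c d a b, h.swap_right d a c b,
    h.swap_right a c d b, h.swap_left a c d b, h.swap_right d a b c, h.swap_right a b d c,
    h.swap_right b d a c, h.swap_left d b c a,
    h.swap_left b d a c, h.swap_left c a b d, h.swap_left a c b d, h.swap_left d b a c]

/-- The product `R_{q r b₁ b₂} R_{s t b₃ b₄}` made alternating in `b₁, …, b₄`; by the antisymmetry of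
`R` only the six shuffles of `b₁, …, b₄` into two pairs are summed. -/
def wedgeSq (q r s t b₁ b₂ b₃ b₄ : ι) : ℝ :=
  R q r b₁ b₂ * R s t b₃ b₄ - R q r b₁ b₃ * R s t b₂ b₄ + R q r b₁ b₄ * R s t b₂ b₃
    + R q r b₂ b₃ * R s t b₁ b₄ - R q r b₂ b₄ * R s t b₁ b₃ + R q r b₃ b₄ * R s t b₁ b₂

/-- The product of three factors `R` with second pairs of indices taken from `b₀, …, b₅`, made
alternating in `b₀, …, b₅`; the sum is over the shuffles of `b₀, …, b₅` into three pairs. The indices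
`a₀, …, a₅` are not alternated. -/
def wedgeCube (a₀ a₁ a₂ a₃ a₄ a₅ b₀ b₁ b₂ b₃ b₄ b₅ : ι) : ℝ :=
  R a₀ a₁ b₀ b₁ * wedgeSq R a₂ a₃ a₄ a₅ b₂ b₃ b₄ b₅
    - R a₀ a₁ b₀ b₂ * wedgeSq R a₂ a₃ a₄ a₅ b₁ b₃ b₄ b₅
    + R a₀ a₁ b₀ b₃ * wedgeSq R a₂ a₃ a₄ a₅ b₁ b₂ b₄ b₅
    - R a₀ a₁ b₀ b₄ * wedgeSq R a₂ a₃ a₄ a₅ b₁ b₂ b₃ b₅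
    + R a₀ a₁ b₀ b₅ * wedgeSq R a₂ a₃ a₄ a₅ b₁ b₂ b₃ b₄
    + R a₀ a₁ b₁ b₂ * wedgeSq R a₂ a₃ a₄ a₅ b₀ b₃ b₄ b₅
    - R a₀ a₁ b₁ b₃ * wedgeSq R a₂ a₃ a₄ a₅ b₀ b₂ b₄ b₅
    + R a₀ a₁ b₁ b₄ * wedgeSq R a₂ a₃ a₄ a₅ b₀ b₂ b₃ b₅
    - R a₀ a₁ b₁ b₅ * wedgeSq R a₂ a₃ a₄ a₅ b₀ b₂ b₃ b₄
    + R a₀ a₁ b₂ b₃ * wedgeSq R a₂ a₃ a₄ a₅ b₀ b₁ b₄ b₅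
    - R a₀ a₁ b₂ b₄ * wedgeSq R a₂ a₃ a₄ a₅ b₀ b₁ b₃ b₅
    + R a₀ a₁ b₂ b₅ * wedgeSq R a₂ a₃ a₄ a₅ b₀ b₁ b₃ b₄
    + R a₀ a₁ b₃ b₄ * wedgeSq R a₂ a₃ a₄ a₅ b₀ b₁ b₂ b₅
    - R a₀ a₁ b₃ b₅ * wedgeSq R a₂ a₃ a₄ a₅ b₀ b₁ b₂ b₄
    + R a₀ a₁ b₄ b₅ * wedgeSq R a₂ a₃ a₄ a₅ b₀ b₁ b₂ b₃

variable {R}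

theorem wedgeCube_swap (hR : ∀ a b c d, R a b c d = -R a b d c) (a b : Fin 6 → ι) (k : Fin 5) :
    wedgeCube R (a 0) (a 1) (a 2) (a 3) (a 4) (a 5)
      ((b ∘ Equiv.swap k.castSucc k.succ) 0) ((b ∘ Equiv.swap k.castSucc k.succ) 1)
      ((b ∘ Equiv.swap k.castSucc k.succ) 2) ((b ∘ Equiv.swap k.castSucc k.succ) 3)
      ((b ∘ Equiv.swap k.castSucc k.succ) 4) ((b ∘ Equiv.swap k.castSucc k.succ) 5) =
    -wedgeCube R (a 0) (a 1) (a 2) (a 3) (a 4) (a 5) (b 0) (b 1) (b 2) (b 3) (b 4) (b 5) := by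
  generalize a 0 = a₀, a 1 = a₁, a 2 = a₂, a 3 = a₃, a 4 = a₄, a 5 = a₅
  match k with
  | 0 =>
    change wedgeCube R _ _ _ _ _ _ (b 1) (b 0) (b 2) (b 3) (b 4) (b 5) = _
    generalize b 0 = b₀, b 1 = b₁, b 2 = b₂, b 3 = b₃, b 4 = b₄, b 5 = b₅
    simp only [wedgeCube, wedgeSq, hR _ _ b₁ b₀]
    ring
  | 1 =>
    change wedgeCube R _ _ _ _ _ _ (b 0) (b 2) (b 1) (b 3) (b 4) (b 5) = _
    generalize b 0 = b₀, b 1 = b₁, b 2 = b₂, b 3 = b₃, b 4 = b₄, b 5 = b₅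
    simp only [wedgeCube, wedgeSq, hR _ _ b₂ b₁]
    ring
  | 2 =>
    change wedgeCube R _ _ _ _ _ _ (b 0) (b 1) (b 3) (b 2) (b 4) (b 5) = _
    generalize b 0 = b₀, b 1 = b₁, b 2 = b₂, b 3 = b₃, b 4 = b₄, b 5 = b₅
    simp only [wedgeCube, wedgeSq, hR _ _ b₃ b₂]
    ring
  | 3 =>
    change wedgeCube R _ _ _ _ _ _ (b 0) (b 1) (b 2) (b 4) (b 3) (b 5) = _
    generalize b 0 = b₀, b 1 = b₁, b 2 = b₂, b 3 = b₃, b 4 = b₄, b 5 = b₅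
    simp only [wedgeCube, wedgeSq, hR _ _ b₄ b₃]
    ring
  | 4 =>
    change wedgeCube R _ _ _ _ _ _ (b 0) (b 1) (b 2) (b 3) (b 5) (b 4) = _
    generalize b 0 = b₀, b 1 = b₁, b 2 = b₂, b 3 = b₃, b 4 = b₄, b 5 = b₅
    simp only [wedgeCube, wedgeSq, hR _ _ b₅ b₄]
    ring

theorem wedgeCube_swap_zero_one (h : IsAlgebraicCurvature R)
    (a₀ a₁ a₂ a₃ a₄ a₅ b₀ b₁ b₂ b₃ b₄ b₅ : ι) :
    wedgeCube R a₁ a₀ a₂ a₃ a₄ a₅ b₁ b₀ b₂ b₃ b₄ b₅ =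
      wedgeCube R a₀ a₁ a₂ a₃ a₄ a₅ b₀ b₁ b₂ b₃ b₄ b₅ := by
  simp only [wedgeCube, wedgeSq, h.swap_left a₁ a₀, h.swap_right _ _ b₁ b₀]
  ring

theorem wedgeCube_swap_block₀₁ (h : IsAlgebraicCurvature R)
    (a₀ a₁ a₂ a₃ a₄ a₅ b₀ b₁ b₂ b₃ b₄ b₅ : ι) :
    wedgeCube R a₂ a₃ a₀ a₁ a₄ a₅ b₂ b₃ b₀ b₁ b₄ b₅ =
      wedgeCube R a₀ a₁ a₂ a₃ a₄ a₅ b₀ b₁ b₂ b₃ b₄ b₅ := by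
  simp only [wedgeCube, wedgeSq, h.swap_right _ _ b₂ b₀, h.swap_right _ _ b₂ b₁,
    h.swap_right _ _ b₃ b₀, h.swap_right _ _ b₃ b₁]
  ring

theorem wedgeCube_swap_block₀₂ (h : IsAlgebraicCurvature R)
    (a₀ a₁ a₂ a₃ a₄ a₅ b₀ b₁ b₂ b₃ b₄ b₅ : ι) :
    wedgeCube R a₄ a₅ a₂ a₃ a₀ a₁ b₄ b₅ b₂ b₃ b₀ b₁ =
      wedgeCube R a₀ a₁ a₂ a₃ a₄ a₅ b₀ b₁ b₂ b₃ b₄ b₅ := by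
  simp only [wedgeCube, wedgeSq, h.swap_right _ _ b₂ b₀, h.swap_right _ _ b₂ b₁,
    h.swap_right _ _ b₃ b₀, h.swap_right _ _ b₃ b₁, h.swap_right _ _ b₄ b₀,
    h.swap_right _ _ b₄ b₁, h.swap_right _ _ b₅ b₀, h.swap_right _ _ b₅ b₁,
    h.swap_right _ _ b₄ b₂, h.swap_right _ _ b₄ b₃, h.swap_right _ _ b₅ b₂, h.swap_right _ _ b₅ b₃]
  ring

end Algebraic

/-! ### The contracted cube in dimension six -/

section Contraction

variable {R : Fin 6 → Fin 6 → Fin 6 → Fin 6 → ℝ}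

theorem sum_vecCons {n : ℕ} {α : Type*} [Fintype α] [DecidableEq α] (f : (Fin (n + 1) → α) → ℝ) :
    ∑ a, f a = ∑ x, ∑ a : Fin n → α, f (Matrix.vecCons x a) := by
  rw [← (Fin.consEquiv fun _ ↦ α).sum_comp, Fintype.sum_prod_type]
  rfl

/-- The contraction of `wedgeCube` over five of the six pairs `(aₖ, bₖ)`. The remaining pair is the
first one; any other choice gives the same tensor, as shown in `six_mul_cubeContraction`. -/
def cubeContraction (R : Fin 6 → Fin 6 → Fin 6 → Fin 6 → ℝ) (i j : Fin 6) : ℝ :=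
  ∑ p, ∑ q, ∑ r, ∑ s, ∑ t, wedgeCube R i p q r s t j p q r s t

/-- In dimension six the tensor `cubeContraction R` is a multiple of the metric. This is the Schouten
identity for `wedgeCube`, with all pairs `(aₖ, bₖ)` contracted afterwards. -/
theorem six_mul_cubeContraction (h : IsAlgebraicCurvature R) (i j : Fin 6) :
    6 * cubeContraction R i j = if i = j then ∑ k, cubeContraction R k k else 0 := by
  classical
  set F : (Fin 6 → Fin 6) → (Fin 6 → Fin 6) → ℝ := fun a b ↦
    wedgeCube R (a 0) (a 1) (a 2) (a 3) (a 4) (a 5) (b 0) (b 1) (b 2) (b 3) (b 4) (b 5)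
  -- `Q k` is the contraction over all pairs but the `k`-th one
  set Q : Fin 6 → Fin 6 → Fin 6 → ℝ := fun k i j ↦
    ∑ a : Fin 6 → Fin 6, if a k = i then F a (Function.update a k j) else 0
  have hF : ∀ a i j, (if i = j then F a a else 0) =
      ∑ k, if a k = i then F a (Function.update a k j) else 0 := fun a ↦
    schouten_identity (F := F a)
      (alternating_of_adjacent fun k b ↦ wedgeCube_swap h.swap_right a b k) a
  have hQ : ∀ σ : Equiv.Perm (Fin 6), (∀ a b, F (a ∘ σ) (b ∘ σ) = F a b) →
      ∀ k i j, Q k i j = Q (σ k) i j := by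
    intro σ hσ k i j
    refine (Fintype.sum_equiv (Equiv.arrowCongr σ (Equiv.refl _)).symm _ _ fun a ↦ ?_).symm
    have h1 : (Equiv.arrowCongr σ (Equiv.refl (Fin 6))).symm a = a ∘ σ := rfl
    have h2 : Function.update (a ∘ σ) k j = Function.update a (σ k) j ∘ σ := by
      rw [Function.update_comp_equiv]; simp
    rw [h1, h2, hσ]
    rfl
  have hQ0 : ∀ i j, Q 0 i j = cubeContraction R i j := by
    intro i j
    simp only [Q, cubeContraction]
    rw [sum_vecCons, Finset.sum_eq_single i]
    · simp only [Matrix.cons_val_zero, if_true]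
      simp only [sum_vecCons]
      simp only [Fintype.sum_unique]
      rfl
    · intro x _ hx
      simp [hx]
    · simp
  -- `σ`, `τ`, `υ` are symmetries of `wedgeCube` that together carry `0` to every other index
  obtain ⟨σ, s0, s1, s2, s3, s4, s5⟩ : ∃ σ : Equiv.Perm (Fin 6),
      σ 0 = 1 ∧ σ 1 = 0 ∧ σ 2 = 2 ∧ σ 3 = 3 ∧ σ 4 = 4 ∧ σ 5 = 5 :=
    ⟨Equiv.swap 0 1, by decide⟩
  have hσ := hQ σ fun a b ↦ by
    simp only [F, Function.comp_apply, s0, s1, s2, s3, s4, s5, wedgeCube_swap_zero_one h]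
  obtain ⟨τ, t0, t1, t2, t3, t4, t5⟩ : ∃ σ : Equiv.Perm (Fin 6),
      σ 0 = 2 ∧ σ 1 = 3 ∧ σ 2 = 0 ∧ σ 3 = 1 ∧ σ 4 = 4 ∧ σ 5 = 5 :=
    ⟨Equiv.swap 0 2 * Equiv.swap 1 3, by decide⟩
  have hτ := hQ τ fun a b ↦ by
    simp only [F, Function.comp_apply, t0, t1, t2, t3, t4, t5, wedgeCube_swap_block₀₁ h]
  obtain ⟨υ, u0, u1, u2, u3, u4, u5⟩ : ∃ σ : Equiv.Perm (Fin 6),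
      σ 0 = 4 ∧ σ 1 = 5 ∧ σ 2 = 2 ∧ σ 3 = 3 ∧ σ 4 = 0 ∧ σ 5 = 1 :=
    ⟨Equiv.swap 0 4 * Equiv.swap 1 5, by decide⟩
  have hυ := hQ υ fun a b ↦ by
    simp only [F, Function.comp_apply, u0, u1, u2, u3, u4, u5, wedgeCube_swap_block₀₂ h]
  have e1 : ∀ i j, Q 1 i j = cubeContraction R i j := fun i j ↦ by rw [← hQ0, hσ 0, s0]
  have e2 : ∀ i j, Q 2 i j = cubeContraction R i j := fun i j ↦ by rw [← hQ0, hτ 0, t0]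
  have e3 : ∀ i j, Q 3 i j = cubeContraction R i j := fun i j ↦ by rw [← e1, hτ 1, t1]
  have e4 : ∀ i j, Q 4 i j = cubeContraction R i j := fun i j ↦ by rw [← hQ0, hυ 0, u0]
  have e5 : ∀ i j, Q 5 i j = cubeContraction R i j := fun i j ↦ by rw [← e1, hυ 1, u1]
  have hP : ∑ k, cubeContraction R k k = ∑ a, F a a := by
    simp only [← hQ0, Q]
    rw [Finset.sum_comm]
    refine Finset.sum_congr rfl fun a _ ↦ ?_
    rw [Finset.sum_ite_eq, if_pos (Finset.mem_univ _), Function.update_eq_self]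
  have hsum : (if i = j then ∑ a, F a a else 0) = ∑ k, Q k i j := by
    rw [Finset.sum_comm, ← Finset.sum_congr rfl fun a _ ↦ hF a i j]
    split_ifs <;> simp
  rw [hP, hsum]
  simp only [Fin.sum_univ_six, hQ0, e1, e2, e3, e4, e5]
  ring

end Contraction

/-! ### Expansion of the contracted cube for Einstein tensors -/

section Sums

variable {ι : Type*} [Fintype ι]

theorem sum_swap_fst (f : ι → ι → ι → ι → ℝ) :
    ∑ q, ∑ r, ∑ s, ∑ t, f q r s t = ∑ q, ∑ r, ∑ s, ∑ t, f r q s t :=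
  Finset.sum_comm

theorem sum_swap_snd (f : ι → ι → ι → ι → ℝ) :
    ∑ q, ∑ r, ∑ s, ∑ t, f q r s t = ∑ q, ∑ r, ∑ s, ∑ t, f q r t s :=
  Finset.sum_congr rfl fun _ _ ↦ Finset.sum_congr rfl fun _ _ ↦ Finset.sum_comm

theorem sum_swap_block (f : ι → ι → ι → ι → ℝ) :
    ∑ q, ∑ r, ∑ s, ∑ t, f q r s t = ∑ q, ∑ r, ∑ s, ∑ t, f s t q r := by
  simp only [← Fintype.sum_prod_type' (f := fun s t ↦ f _ _ s t)]
  simp only [← Fintype.sum_prod_type' (f := fun q r ↦ ∑ x : ι × ι, f q r x.1 x.2)]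
  rw [Finset.sum_comm]
  simp only [Fintype.sum_prod_type]

end Sums

section Expansion

variable {R : Fin 6 → Fin 6 → Fin 6 → Fin 6 → ℝ} {l : ℝ}

theorem wedgeSq_swap_fst_pair (h : IsAlgebraicCurvature R) (q r s t b₁ b₂ b₃ b₄ : Fin 6) :
    wedgeSq R r q s t b₁ b₂ b₃ b₄ = -wedgeSq R q r s t b₁ b₂ b₃ b₄ := by
  simp only [wedgeSq, h.swap_left r q]; ring

theorem wedgeSq_swap_snd_pair (h : IsAlgebraicCurvature R) (q r s t b₁ b₂ b₃ b₄ : Fin 6) :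
    wedgeSq R q r t s b₁ b₂ b₃ b₄ = -wedgeSq R q r s t b₁ b₂ b₃ b₄ := by
  simp only [wedgeSq, h.swap_left t s]; ring

theorem wedgeSq_swap_block (q r s t b₁ b₂ b₃ b₄ : Fin 6) :
    wedgeSq R s t q r b₁ b₂ b₃ b₄ = wedgeSq R q r s t b₁ b₂ b₃ b₄ := by
  simp only [wedgeSq]; ring

theorem wedgeSq_swap₂₃ (h : IsAlgebraicCurvature R) (q r s t b₁ b₂ b₃ b₄ : Fin 6) :
    wedgeSq R q r s t b₁ b₃ b₂ b₄ = -wedgeSq R q r s t b₁ b₂ b₃ b₄ := by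
  simp only [wedgeSq, h.swap_right _ _ b₃ b₂]; ring

theorem wedgeSq_swap₃₄ (h : IsAlgebraicCurvature R) (q r s t b₁ b₂ b₃ b₄ : Fin 6) :
    wedgeSq R q r s t b₁ b₂ b₄ b₃ = -wedgeSq R q r s t b₁ b₂ b₃ b₄ := by
  simp only [wedgeSq, h.swap_right _ _ b₄ b₃]; ring

/-- An algebraic curvature tensor whose Ricci tensor is `l` times the metric. -/
structure IsEinsteinCurvature (R : Fin 6 → Fin 6 → Fin 6 → Fin 6 → ℝ) (l : ℝ) : Prop extends
    IsAlgebraicCurvature R where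
  ricci_eq : ∀ i j, ∑ a, R a i j a = if i = j then l else 0

theorem sum_first_third (h : IsEinsteinCurvature R l) (i j : Fin 6) :
    ∑ a, R a i a j = if i = j then -l else 0 := by
  rw [Finset.sum_congr rfl fun a _ ↦ h.swap_right a i a j, Finset.sum_neg_distrib, h.ricci_eq]
  split_ifs <;> simp

theorem sum_second_third (h : IsEinsteinCurvature R l) (i j : Fin 6) :
    ∑ a, R i a a j = if i = j then l else 0 := by
  rw [Finset.sum_congr rfl fun a _ ↦ h.swap_left i a a j, Finset.sum_neg_distrib,
    sum_first_third h]
  split_ifs <;> simp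

theorem sum_second_fourth (h : IsEinsteinCurvature R l) (i j : Fin 6) :
    ∑ a, R i a j a = if i = j then -l else 0 := by
  rw [Finset.sum_congr rfl fun a _ ↦ h.swap_left i a j a, Finset.sum_neg_distrib, h.ricci_eq]
  split_ifs <;> simp

/-- Contraction of `wedgeSq` over the pair of indices of one factor. -/
theorem wedgeSq_contract_pair (h : IsEinsteinCurvature R l) (q r b c : Fin 6) :
    ∑ s, ∑ t, wedgeSq R q r s t b c s t =
      -2 * l * R q r b c + ∑ s, ∑ t, R q r s t * R s t b c := by
  have e1 : ∑ s, ∑ t, R q r b c * R s t s t = -6 * l * R q r b c := by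
    simp only [← Finset.mul_sum, sum_second_fourth h]; simp; ring
  have e2 : ∑ s, ∑ t, R q r b s * R s t c t = -l * R q r b c := by
    simp only [← Finset.mul_sum, sum_second_fourth h]; simp; ring
  have e3 : ∑ s, ∑ t, R q r b t * R s t c s = l * R q r b c := by
    rw [Finset.sum_comm]
    simp only [← Finset.mul_sum, h.ricci_eq]; simp; ring
  have e4 : ∑ s, ∑ t, R q r c s * R s t b t = l * R q r b c := by
    simp only [← Finset.mul_sum, sum_second_fourth h]; simp [h.swap_right q r c b]; ring
  have e5 : ∑ s, ∑ t, R q r c t * R s t b s = -l * R q r b c := by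
    rw [Finset.sum_comm]
    simp only [← Finset.mul_sum, h.ricci_eq]; simp [h.swap_right q r c b]; ring
  simp only [wedgeSq, Finset.sum_add_distrib, Finset.sum_sub_distrib, e1, e2, e3, e4, e5]
  ring

theorem wedgeSq_contract_triple (h : IsEinsteinCurvature R l) (q p : Fin 6) :
    ∑ r, ∑ s, ∑ t, wedgeSq R q r s t p r s t =
      2 * l ^ 2 * (if q = p then 1 else 0) + ∑ a, ∑ b, ∑ c, R q a b c * R p a b c := by
  simp only [wedgeSq_contract_pair h, Finset.sum_add_distrib, ← Finset.mul_sum, sum_second_fourth h]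
  congr 1
  · split_ifs <;> ring
  · simp only [h.pair_symm _ _ p]

/-- Contraction of `wedgeSq` over one index of each factor. -/
theorem wedgeSq_contract_mixed (h : IsEinsteinCurvature R l) (q s j p : Fin 6) :
    ∑ r, ∑ t, wedgeSq R q r s t j p r t =
      -2 * l * R q s j p + l ^ 2 * ((if q = p then 1 else 0) * (if s = j then 1 else 0)
        - (if q = j then 1 else 0) * (if s = p then 1 else 0))
      + ∑ r, ∑ t, R q r j t * R s t p r - ∑ r, ∑ t, R q r p t * R s t j r := by
  have e1 : ∑ r, ∑ t, R q r j p * R s t r t = -l * R q s j p := by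
    simp only [← Finset.mul_sum, sum_second_fourth h]; simp [mul_comm]
  have e2 : ∑ r, ∑ t, R q r j r * R s t p t =
      l ^ 2 * ((if q = j then 1 else 0) * (if s = p then 1 else 0)) := by
    simp only [← Finset.mul_sum, ← Finset.sum_mul, sum_second_fourth h]; split_ifs <;> simp; ring
  have e4 : ∑ r, ∑ t, R q r p r * R s t j t =
      l ^ 2 * ((if q = p then 1 else 0) * (if s = j then 1 else 0)) := by
    simp only [← Finset.mul_sum, ← Finset.sum_mul, sum_second_fourth h]; split_ifs <;> simp; ring
  have e6 : ∑ r, ∑ t, R q r r t * R s t j p = -l * R q s j p := by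
    rw [Finset.sum_comm]
    simp only [← Finset.sum_mul, sum_second_third h]; simp [h.swap_left s q]
  simp only [wedgeSq, Finset.sum_add_distrib, Finset.sum_sub_distrib, e1, e2, e4, e6]
  ring

/-- Three of the four contractions of a vector with `wedgeSq` agree with the first one up to sign. -/
theorem sum_single_mul_wedgeSq (h : IsAlgebraicCurvature R) (c : Fin 6 → ℝ) (p : Fin 6) :
    (∑ q, ∑ r, ∑ s, ∑ t, c r * wedgeSq R q r s t p q s t =
        -∑ q, c q * ∑ r, ∑ s, ∑ t, wedgeSq R q r s t p r s t) ∧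
    (∑ q, ∑ r, ∑ s, ∑ t, c s * wedgeSq R q r s t p q r t =
        ∑ q, c q * ∑ r, ∑ s, ∑ t, wedgeSq R q r s t p r s t) ∧
    (∑ q, ∑ r, ∑ s, ∑ t, c t * wedgeSq R q r s t p q r s =
        -∑ q, c q * ∑ r, ∑ s, ∑ t, wedgeSq R q r s t p r s t) := by
  have h2 : ∑ q, ∑ r, ∑ s, ∑ t, c s * wedgeSq R q r s t p q r t =
      ∑ q, c q * ∑ r, ∑ s, ∑ t, wedgeSq R q r s t p r s t := by
    rw [sum_swap_block]
    simp only [Finset.mul_sum]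
    refine Finset.sum_congr rfl fun q _ ↦ Finset.sum_congr rfl fun r _ ↦
      Finset.sum_congr rfl fun s _ ↦ Finset.sum_congr rfl fun t _ ↦ ?_
    rw [wedgeSq_swap_block, wedgeSq_swap₃₄ h, wedgeSq_swap₂₃ h, neg_neg]
  refine ⟨?_, h2, ?_⟩
  · rw [sum_swap_fst]
    simp only [Finset.mul_sum, ← Finset.sum_neg_distrib]
    refine Finset.sum_congr rfl fun q _ ↦ Finset.sum_congr rfl fun r _ ↦
      Finset.sum_congr rfl fun s _ ↦ Finset.sum_congr rfl fun t _ ↦ ?_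
    rw [wedgeSq_swap_fst_pair h, mul_neg]
  · rw [sum_swap_snd, ← h2]
    simp only [← Finset.sum_neg_distrib]
    refine Finset.sum_congr rfl fun q _ ↦ Finset.sum_congr rfl fun r _ ↦
      Finset.sum_congr rfl fun s _ ↦ Finset.sum_congr rfl fun t _ ↦ ?_
    rw [wedgeSq_swap_snd_pair h, mul_neg]

theorem sum_pair_mul_wedgeSq (c : Fin 6 → Fin 6 → ℝ) (j p : Fin 6) :
    ∑ q, ∑ r, ∑ s, ∑ t, c s t * wedgeSq R q r s t j p q r =
      ∑ q, ∑ r, c q r * ∑ s, ∑ t, wedgeSq R q r s t j p s t := by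
  rw [sum_swap_block]
  simp only [Finset.mul_sum]
  refine Finset.sum_congr rfl fun q _ ↦ Finset.sum_congr rfl fun r _ ↦
    Finset.sum_congr rfl fun s _ ↦ Finset.sum_congr rfl fun t _ ↦ ?_
  rw [wedgeSq_swap_block]

/-- The four ways of choosing one index from each factor of `wedgeSq` give the same contraction up to
sign. -/
theorem sum_mixed_mul_wedgeSq (h : IsAlgebraicCurvature R) (c : Fin 6 → Fin 6 → ℝ) (j p : Fin 6) :
    (∑ q, ∑ r, ∑ s, ∑ t, c q s * wedgeSq R q r s t j p r t =
        ∑ q, ∑ s, c q s * ∑ r, ∑ t, wedgeSq R q r s t j p r t) ∧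
    (∑ q, ∑ r, ∑ s, ∑ t, c q t * wedgeSq R q r s t j p r s =
        -∑ q, ∑ s, c q s * ∑ r, ∑ t, wedgeSq R q r s t j p r t) ∧
    (∑ q, ∑ r, ∑ s, ∑ t, c r s * wedgeSq R q r s t j p q t =
        -∑ q, ∑ s, c q s * ∑ r, ∑ t, wedgeSq R q r s t j p r t) ∧
    (∑ q, ∑ r, ∑ s, ∑ t, c r t * wedgeSq R q r s t j p q s =
        ∑ q, ∑ s, c q s * ∑ r, ∑ t, wedgeSq R q r s t j p r t) := by
  have h1 : ∑ q, ∑ r, ∑ s, ∑ t, c q s * wedgeSq R q r s t j p r t =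
        ∑ q, ∑ s, c q s * ∑ r, ∑ t, wedgeSq R q r s t j p r t := by
    simp only [Finset.mul_sum]
    exact Finset.sum_congr rfl fun q _ ↦ Finset.sum_comm
  have h2 : ∑ q, ∑ r, ∑ s, ∑ t, c q t * wedgeSq R q r s t j p r s =
        -∑ q, ∑ s, c q s * ∑ r, ∑ t, wedgeSq R q r s t j p r t := by
    rw [sum_swap_snd, ← h1]
    simp only [← Finset.sum_neg_distrib]
    refine Finset.sum_congr rfl fun q _ ↦ Finset.sum_congr rfl fun r _ ↦
      Finset.sum_congr rfl fun s _ ↦ Finset.sum_congr rfl fun t _ ↦ ?_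
    rw [wedgeSq_swap_snd_pair h, mul_neg]
  refine ⟨h1, h2, ?_, ?_⟩
  · rw [sum_swap_fst, ← h1]
    simp only [← Finset.sum_neg_distrib]
    refine Finset.sum_congr rfl fun q _ ↦ Finset.sum_congr rfl fun r _ ↦
      Finset.sum_congr rfl fun s _ ↦ Finset.sum_congr rfl fun t _ ↦ ?_
    rw [wedgeSq_swap_fst_pair h, mul_neg]
  · rw [sum_swap_fst, ← neg_inj, ← h2]
    simp only [← Finset.sum_neg_distrib]
    refine Finset.sum_congr rfl fun q _ ↦ Finset.sum_congr rfl fun r _ ↦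
      Finset.sum_congr rfl fun s _ ↦ Finset.sum_congr rfl fun t _ ↦ ?_
    rw [wedgeSq_swap_fst_pair h, mul_neg, neg_neg]

/-- The fifteen shuffles in `wedgeCube` fall into five classes, according to the positions of the pair
of indices that the first factor receives; shuffles of one class have equal contractions. -/
theorem cubeContraction_eq_wedgeSq (h : IsAlgebraicCurvature R) (i j : Fin 6) :
    cubeContraction R i j =
      (∑ p, R i p j p) * (∑ q, ∑ r, ∑ s, ∑ t, wedgeSq R q r s t q r s t)
      - 4 * ∑ p, ∑ q, R i p j q * ∑ r, ∑ s, ∑ t, wedgeSq R q r s t p r s t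
      + 4 * ∑ p, ∑ q, R i p p q * ∑ r, ∑ s, ∑ t, wedgeSq R q r s t j r s t
      + 2 * ∑ p, ∑ q, ∑ r, R i p q r * ∑ s, ∑ t, wedgeSq R q r s t j p s t
      - 4 * ∑ p, ∑ q, ∑ s, R i p q s * ∑ r, ∑ t, wedgeSq R q r s t j p r t := by
  rw [Finset.sum_mul, Finset.mul_sum, Finset.mul_sum, Finset.mul_sum, Finset.mul_sum,
    ← Finset.sum_sub_distrib, ← Finset.sum_add_distrib, ← Finset.sum_add_distrib,
    ← Finset.sum_sub_distrib, cubeContraction]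
  refine Finset.sum_congr rfl fun p _ ↦ ?_
  obtain ⟨a2, a3, a4⟩ := sum_single_mul_wedgeSq h (R i p j) p
  obtain ⟨b2, b3, b4⟩ := sum_single_mul_wedgeSq h (R i p p) j
  have c2 := sum_pair_mul_wedgeSq (R := R) (R i p) j p
  obtain ⟨d1, d2, d3, d4⟩ := sum_mixed_mul_wedgeSq h (R i p) j p
  have a1 : ∑ q, ∑ r, ∑ s, ∑ t, R i p j q * wedgeSq R q r s t p r s t =
      ∑ q, R i p j q * ∑ r, ∑ s, ∑ t, wedgeSq R q r s t p r s t := by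
    simp only [Finset.mul_sum]
  have b1 : ∑ q, ∑ r, ∑ s, ∑ t, R i p p q * wedgeSq R q r s t j r s t =
      ∑ q, R i p p q * ∑ r, ∑ s, ∑ t, wedgeSq R q r s t j r s t := by
    simp only [Finset.mul_sum]
  have c1 : ∑ q, ∑ r, ∑ s, ∑ t, R i p q r * wedgeSq R q r s t j p s t =
      ∑ q, ∑ r, R i p q r * ∑ s, ∑ t, wedgeSq R q r s t j p s t := by
    simp only [Finset.mul_sum]
  have e1 : ∑ q, ∑ r, ∑ s, ∑ t, R i p j p * wedgeSq R q r s t q r s t =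
      R i p j p * ∑ q, ∑ r, ∑ s, ∑ t, wedgeSq R q r s t q r s t := by
    simp only [Finset.mul_sum]
  simp only [wedgeCube, Finset.sum_add_distrib, Finset.sum_sub_distrib, e1, a1, a2, a3, a4,
    b1, b2, b3, b4, c1, c2, d1, d2, d3, d4]
  ring

end Expansion

section Invariants

variable (R : Fin 6 → Fin 6 → Fin 6 → Fin 6 → ℝ)

/-- The tensor `∑ R_iabc R_jabc`. -/
def sqContraction (i j : Fin 6) : ℝ := ∑ a, ∑ b, ∑ c, R i a b c * R j a b c

/-- The tensor `Ř_ij = ∑ R_iuvj R_abcu R_abcv`. -/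
def checkContraction (i j : Fin 6) : ℝ :=
  ∑ u, ∑ v, ∑ a, ∑ b, ∑ c, R i u v j * R a b c u * R a b c v

/-- The tensor `R̂_ij = ∑ R_ibac R_jbuv R_acuv`. -/
def hatContraction (i j : Fin 6) : ℝ :=
  ∑ a, ∑ b, ∑ c, ∑ u, ∑ v, R i b a c * R j b u v * R a c u v

/-- The tensor `R̊_ij = ∑ R_iabc R_jubv R_aucv`. -/
def ringContraction (i j : Fin 6) : ℝ :=
  ∑ a, ∑ b, ∑ c, ∑ u, ∑ v, R i a b c * R j u b v * R a u c v

variable {R} {l : ℝ}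

theorem IsAlgebraicCurvature.bianchi_right (h : IsAlgebraicCurvature R) (a b c d : Fin 6) :
    R a b c d + R a c d b + R a d b c = 0 := by
  have e : ∀ x y z, R a x y z = R z y x a := fun x y z ↦ by
    rw [h.pair_symm, h.swap_left, h.swap_right, neg_neg]
  rw [e, e, e]
  linarith [h.bianchi d c b a]

/-- `Ř` is the curvature acting on the symmetric tensor `∑ R_uabc R_vabc`. -/
theorem checkContraction_eq (h : IsAlgebraicCurvature R) (i j : Fin 6) :
    checkContraction R i j = ∑ p, ∑ q, R i p q j * sqContraction R p q := by
  simp only [checkContraction, sqContraction]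
  refine Finset.sum_congr rfl fun u _ ↦ Finset.sum_congr rfl fun v _ ↦ ?_
  simp only [mul_assoc, ← Finset.mul_sum]
  congr 1
  calc ∑ a, ∑ b, ∑ c, R a b c u * R a b c v = ∑ a, ∑ b, ∑ c, R u c b a * R v c b a := by
        refine Finset.sum_congr rfl fun a _ ↦ Finset.sum_congr rfl fun b _ ↦
          Finset.sum_congr rfl fun c _ ↦ ?_
        rw [h.pair_symm a b c u, h.pair_symm a b c v, h.swap_left c u, h.swap_left c v,
          h.swap_right u c, h.swap_right v c]
        ring
    _ = _ := by
        rw [Finset.sum_congr rfl fun a _ ↦ Finset.sum_comm, Finset.sum_comm]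
        exact Finset.sum_congr rfl fun a _ ↦ Finset.sum_comm

/-- The cubic contraction that arises from the shuffles splitting both pairs of indices. The Bianchi
identity, applied to each of the three factors, expresses it by `R̊_ij` and `R̂_ij`. -/
theorem sum_eq_ringContraction_sub (h : IsAlgebraicCurvature R) (i j : Fin 6) :
    ∑ p, ∑ q, ∑ s, R i p q s * ∑ r, ∑ t, R q r j t * R s t p r =
      ringContraction R i j - hatContraction R i j / 4 := by
  have hV : ∑ p, ∑ q, ∑ s, ∑ t, ∑ r, R i p q s * R j t q r * R p s r t =
      -(hatContraction R i j / 4) := by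
    have hH : hatContraction R i j = ∑ q, ∑ p, ∑ s, ∑ t, ∑ r, R i q p s * R j q t r * R p s t r :=
      Finset.sum_comm
    rw [hH, Finset.sum_comm, Finset.sum_div, ← Finset.sum_neg_distrib]
    refine Finset.sum_congr rfl fun q _ ↦ ?_
    have k1 : 2 * ∑ p, ∑ s, ∑ t, ∑ r, R i p q s * R j t q r * R p s r t =
        ∑ p, ∑ s, ∑ t, ∑ r, R i q p s * R j t q r * R p s r t := by
      rw [two_mul]
      nth_rewrite 2 [sum_swap_fst]
      simp only [← Finset.sum_add_distrib]
      refine Finset.sum_congr rfl fun p _ ↦ Finset.sum_congr rfl fun s _ ↦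
        Finset.sum_congr rfl fun t _ ↦ Finset.sum_congr rfl fun r _ ↦ ?_
      rw [h.swap_left s p]
      -- only the part of `R i p q s` antisymmetric in `p`, `s` contributes
      have e : R i p q s - R i s q p = R i q p s := by
        linarith [h.bianchi_right i p q s, h.swap_right i s p q, h.swap_right i q p s]
      rw [← e]; ring
    -- the same antisymmetrization for the second factor, in `t` and `r`
    have k2 : 2 * ∑ p, ∑ s, ∑ t, ∑ r, R i q p s * R j t q r * R p s r t =
        -∑ p, ∑ s, ∑ t, ∑ r, R i q p s * R j q t r * R p s t r := by
      rw [two_mul]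
      nth_rewrite 2 [sum_swap_snd]
      simp only [← Finset.sum_add_distrib, ← Finset.sum_neg_distrib]
      refine Finset.sum_congr rfl fun p _ ↦ Finset.sum_congr rfl fun s _ ↦
        Finset.sum_congr rfl fun t _ ↦ Finset.sum_congr rfl fun r _ ↦ ?_
      rw [h.swap_right p s r t]
      have e : R j t q r - R j r q t = R j q t r := by
        linarith [h.bianchi_right j t q r, h.swap_right j r t q, h.swap_right j q t r]
      rw [← e]; ring
    linarith
  rw [sub_eq_add_neg, ← hV, ringContraction]
  simp only [← Finset.sum_add_distrib]
  refine Finset.sum_congr rfl fun p _ ↦ Finset.sum_congr rfl fun q _ ↦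
    Finset.sum_congr rfl fun s _ ↦ ?_
  rw [Finset.sum_comm, Finset.mul_sum]
  refine Finset.sum_congr rfl fun t _ ↦ ?_
  rw [Finset.mul_sum]
  refine Finset.sum_congr rfl fun r _ ↦ ?_
  have e : R s t p r = R p t s r + R p s r t := by
    linarith [h.bianchi p r s t, h.pair_symm s t p r, h.pair_symm r s p t, h.swap_right p t r s,
      h.swap_left s p r t]
  rw [e, h.pair_symm q r j t]
  ring

/-- The contracted cube of an Einstein tensor; here `6 * l` is the scalar curvature. -/
theorem cubeContraction_eq (h : IsEinsteinCurvature R l) (i j : Fin 6) :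
    cubeContraction R i j =
      (-4 * l ^ 3 - l * ∑ k, sqContraction R k k) * (if i = j then 1 else 0)
        + 4 * checkContraction R i j + 8 * l * sqContraction R i j
        + 4 * hatContraction R i j - 8 * ringContraction R i j := by
  have hK := checkContraction_eq h.toIsAlgebraicCurvature i j
  have hU := sum_eq_ringContraction_sub h.toIsAlgebraicCurvature i j
  have hsq : ∀ q p, ∑ r, ∑ s, ∑ t, wedgeSq R q r s t p r s t =
      2 * l ^ 2 * (if q = p then 1 else 0) + sqContraction R q p := wedgeSq_contract_triple h
  have e1 : ∑ q, ∑ r, ∑ s, ∑ t, wedgeSq R q r s t q r s t = 12 * l ^ 2 + ∑ k, sqContraction R k k := by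
    simp only [hsq, Finset.sum_add_distrib]; simp; ring
  have e2 : ∑ p, ∑ q, R i p j q * ∑ r, ∑ s, ∑ t, wedgeSq R q r s t p r s t =
      -2 * l ^ 3 * (if i = j then 1 else 0) - checkContraction R i j := by
    have k1 : ∑ p, ∑ q, R i p j q * (2 * l ^ 2 * (if q = p then 1 else 0)) =
        -2 * l ^ 3 * (if i = j then 1 else 0) := by
      simp only [mul_ite, mul_one, mul_zero, Finset.sum_ite_eq', Finset.mem_univ, if_true,
        ← Finset.sum_mul, sum_second_fourth h]
      split_ifs <;> ring
    have k2 : ∑ p, ∑ q, R i p j q * sqContraction R q p = -checkContraction R i j := by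
      rw [hK, ← Finset.sum_neg_distrib]
      refine Finset.sum_congr rfl fun p _ ↦ ?_
      rw [← Finset.sum_neg_distrib]
      refine Finset.sum_congr rfl fun q _ ↦ ?_
      have : sqContraction R q p = sqContraction R p q := by simp only [sqContraction, mul_comm]
      rw [this, h.swap_right i p j q]; ring
    simp only [hsq, mul_add, Finset.sum_add_distrib, k1, k2]
    ring
  have e3 : ∑ p, ∑ q, R i p p q * ∑ r, ∑ s, ∑ t, wedgeSq R q r s t j r s t =
      2 * l ^ 3 * (if i = j then 1 else 0) + l * sqContraction R i j := by
    rw [Finset.sum_comm]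
    simp only [hsq, ← Finset.sum_mul, sum_second_third h]
    simp only [ite_mul, zero_mul, Finset.sum_ite_eq, Finset.mem_univ, if_true]
    ring
  have e4 : ∑ p, ∑ q, ∑ r, R i p q r * ∑ s, ∑ t, wedgeSq R q r s t j p s t =
      -2 * l * sqContraction R i j + hatContraction R i j := by
    have k1 : ∑ p, ∑ q, ∑ r, R i p q r * (-2 * l * R q r j p) = -2 * l * sqContraction R i j := by
      simp only [sqContraction, Finset.mul_sum]
      refine Finset.sum_congr rfl fun p _ ↦ Finset.sum_congr rfl fun q _ ↦
        Finset.sum_congr rfl fun r _ ↦ ?_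
      rw [h.pair_symm q r]; ring
    have k2 : ∑ p, ∑ q, ∑ r, R i p q r * ∑ s, ∑ t, R q r s t * R s t j p =
        hatContraction R i j := by
      rw [hatContraction, Finset.sum_comm]
      simp only [Finset.mul_sum]
      refine Finset.sum_congr rfl fun q _ ↦ Finset.sum_congr rfl fun p _ ↦
        Finset.sum_congr rfl fun r _ ↦ Finset.sum_congr rfl fun s _ ↦
        Finset.sum_congr rfl fun t _ ↦ ?_
      rw [h.pair_symm s t]; ring
    simp only [wedgeSq_contract_pair h, mul_add, Finset.sum_add_distrib, k1, k2]
  have e5 : ∑ p, ∑ q, ∑ s, R i p q s * ∑ r, ∑ t, wedgeSq R q r s t j p r t =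
      -2 * l * sqContraction R i j + 2 * l ^ 3 * (if i = j then 1 else 0)
        + 2 * (ringContraction R i j - hatContraction R i j / 4) := by
    have k1 : ∑ p, ∑ q, ∑ s, R i p q s * (-2 * l * R q s j p) = -2 * l * sqContraction R i j := by
      simp only [sqContraction, Finset.mul_sum]
      refine Finset.sum_congr rfl fun p _ ↦ Finset.sum_congr rfl fun q _ ↦
        Finset.sum_congr rfl fun r _ ↦ ?_
      rw [h.pair_symm q r]; ring
    have k2 : ∑ p, ∑ q, ∑ s, R i p q s * (l ^ 2 * ((if q = p then 1 else 0) *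
        (if s = j then 1 else 0) - (if q = j then 1 else 0) * (if s = p then 1 else 0))) =
        2 * l ^ 3 * (if i = j then 1 else 0) := by
      simp only [mul_sub, Finset.sum_sub_distrib, mul_ite, mul_one, mul_zero,
        Finset.sum_ite_eq', Finset.mem_univ, if_true]
      simp only [← Finset.sum_mul, sum_second_fourth h, sum_second_third h]
      split_ifs <;> ring
    have k3 : ∑ p, ∑ q, ∑ s, R i p q s * ∑ r, ∑ t, R q r p t * R s t j r =
        -(ringContraction R i j - hatContraction R i j / 4) := by
      rw [← hU, ← Finset.sum_neg_distrib]
      refine Finset.sum_congr rfl fun p _ ↦ ?_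
      rw [Finset.sum_comm, ← Finset.sum_neg_distrib]
      refine Finset.sum_congr rfl fun q _ ↦ ?_
      rw [← Finset.sum_neg_distrib]
      refine Finset.sum_congr rfl fun s _ ↦ ?_
      rw [h.swap_right i p s q, neg_mul]
      congr 2
      rw [Finset.sum_comm]
      exact Finset.sum_congr rfl fun r _ ↦ Finset.sum_congr rfl fun t _ ↦ mul_comm _ _
    simp only [wedgeSq_contract_mixed h, mul_add, mul_sub (R _ _ _ _) (_ + _) _,
      Finset.sum_add_distrib, Finset.sum_sub_distrib, k1, k2, k3, hU]
    ring
  rw [cubeContraction_eq_wedgeSq h.toIsAlgebraicCurvature, sum_second_fourth h, e1, e2, e3, e4, e5]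
  split_ifs <;> ring

/-- The curvature identity for Einstein algebraic curvature tensors in dimension six, where the scalar
curvature is `6 * l`. -/
theorem curvature_identity (h : IsEinsteinCurvature R l) (i j : Fin 6) :
    (-(6 * l * ∑ k, sqContraction R k k) + 4 * ∑ k, ringContraction R k k
          - 2 * ∑ k, hatContraction R k k)
        * (if i = j then 1 else 0)
      + 12 * checkContraction R i j + 12 * hatContraction R i j - 24 * ringContraction R i j
      + 4 * (6 * l) * sqContraction R i j = 0 := by
  have hch : ∑ k, checkContraction R k k = l * ∑ k, sqContraction R k k := by
    simp only [checkContraction_eq h.toIsAlgebraicCurvature]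
    rw [Finset.sum_comm, Finset.mul_sum]
    refine Finset.sum_congr rfl fun p _ ↦ ?_
    rw [Finset.sum_comm]
    simp only [← Finset.sum_mul, h.ricci_eq]
    simp
  have h6 := six_mul_cubeContraction h.toIsAlgebraicCurvature i j
  simp only [cubeContraction_eq h, Finset.sum_sub_distrib, Finset.sum_add_distrib,
    ← Finset.mul_sum, hch] at h6
  simp at h6
  split_ifs at h6 ⊢ <;> linarith

end Invariants

end RiemannianCurvature

end

theorem mainTheorem6 {M : Type*} [TopologicalSpace M]
    [ChartedSpace (EuclideanSpace ℝ (Fin 6)) M] [IsManifold (𝓡 6) ∞ M]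
    [RiemannianBundle (fun x : M ↦ TangentSpace (𝓡 6) x)]
    [IsContMDiffRiemannianBundle (𝓡 6) ∞ (EuclideanSpace ℝ (Fin 6))
      (fun x : M ↦ TangentSpace (𝓡 6) x)]
    (hM : RiemannianCurvature.IsEinstein (𝓡 6) M)
    (x : M) (e : OrthonormalBasis (Fin 6) ℝ (TangentSpace (𝓡 6) x)) (i j : Fin 6) :
    (-(RiemannianCurvature.scalarCurvature e * RiemannianCurvature.RmNormSq e)
        + 4 * RiemannianCurvature.ringR e - 2 * RiemannianCurvature.hatR e)
          * RiemannianCurvature.metricComp e i j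
      + 12 * RiemannianCurvature.checkTensor e i j
      + 12 * RiemannianCurvature.hatTensor e i j
      - 24 * RiemannianCurvature.ringTensor e i j
      + 4 * RiemannianCurvature.scalarCurvature e * RiemannianCurvature.RmSqTensor e i j = 0 := by
  set l := RiemannianCurvature.scalarCurvature e / 6 with hl
  have hmet : ∀ i j, RiemannianCurvature.metricComp e i j = if i = j then 1 else 0 :=
    fun i j ↦ orthonormal_iff_ite.1 e.orthonormal i j
  have hE : RiemannianCurvature.IsEinsteinCurvature (RiemannianCurvature.Rm e) l :=
    { swap_left := RiemannianCurvature.Rm_swap_left e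
      swap_right := RiemannianCurvature.Rm_swap_right e
      bianchi := RiemannianCurvature.Rm_bianchi e
      ricci_eq := fun i j ↦ by
        have h := hM x 6 e i j
        rw [hmet] at h
        simpa [RiemannianCurvature.ricci, hl] using h }
  have hτ : RiemannianCurvature.scalarCurvature e = 6 * l := by rw [hl]; ring
  have hnorm : RiemannianCurvature.RmNormSq e =
      ∑ k, RiemannianCurvature.sqContraction (RiemannianCurvature.Rm e) k k := by
    simp only [RiemannianCurvature.RmNormSq, RiemannianCurvature.sqContraction, sq]
  have hhat : RiemannianCurvature.hatR e =
      ∑ k, RiemannianCurvature.hatContraction (RiemannianCurvature.Rm e) k k :=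
    Finset.sum_congr rfl fun _ _ ↦ Finset.sum_comm
  have h := RiemannianCurvature.curvature_identity hE i j
  rw [← hτ, ← hnorm, ← hhat, ← hmet] at h
  exact h
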